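/- A \emph{tree with distinguished children} is an ordered (plane) rooted tree in which every node that has at least one child has exactly one of its children distinguished. Let $a_n$ be the number of such trees with $n$ nodes, and let $A(z)=\sum_n a_nz^n$. Let $F(z,w)=\sum_{t} z^{|t|}w^{\deg t}$, where $t$ runs over all these trees, $|t|$ is the number of nodes of $t$, and $\deg t$ is the degree of the root, that is, the number of its children. Then, as formal power series, $$F(z,w)=z+z\,\frac{wA(z)}{(1-wA(z))^2},\qquad D(z):=\frac{\partial F}{\partial w}(z,w)\Big|_{w=1}=\frac{zA(z)\,(A(z)+1)}{(1-A(z))^3}.$$ For $n\ge1$ the expected degree of the root of a uniformly random tree with distinguished children and $n$ nodes equals $[z^n]D(z)/[z^n]A(z)$. As $n\to\infty$ it converges to $$c=\rho\,\frac{1+4\tau+\tau^2}{(1-\tau)^4},\qquad \rho=\frac{\tau}{1+\tau/(1-\tau)^2},$$ where $\tau\in(0,1)$ is the real root of $-1+3\tau-\tau^2+\tau^3=0$. Numerically, $2.960894939<c<2.960894940$. For comparison, the expected degree of the root of a uniformly random ordered tree with $n$ nodes converges to $3$ as $n\to\infty$. -/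

import Mathlib

/-- Ordered (plane) trees: a root with a finite sequence of `k ≥ 0` ordered trees as subtrees. -/
inductive OrderedTree : Type
  | node (k : ℕ) (child : Fin k → OrderedTree) : OrderedTree

/-- Ordered trees with distinguished children: every node that has children (`k + 1` of them, in
order) carries the position `d` of exactly one distinguished child. -/
inductive DistTree : Type
  | leaf : DistTree
  | node (k : ℕ) (d : Fin (k + 1)) (child : Fin (k + 1) → DistTree) : DistTree

namespace OrderedTree

/-- The number of nodes. -/
def size : OrderedTree → ℕ
  | node _ child => 1 + ∑ i, (child i).size

/-- The number of children of the root. -/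
def rootDegree : OrderedTree → ℕ
  | node k _ => k

theorem finite_size_le (n : ℕ) : {t : OrderedTree | t.size ≤ n}.Finite := by
  induction n with
  | zero =>
    refine Set.Finite.subset Set.finite_empty ?_
    rintro ⟨k, c⟩ h
    simp [size] at h
  | succ n ih =>
    refine Set.Finite.subset (Set.finite_iUnion (fun k : Fin (n + 1) =>
      (Set.Finite.pi' (fun _ : Fin (k : ℕ) => ih)).image (OrderedTree.node k))) ?_
    rintro ⟨k, c⟩ h
    simp only [Set.mem_ofPred_eq, size] at h
    have pos : ∀ t : OrderedTree, 1 ≤ t.size := by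
      rintro ⟨k, c⟩
      simp [size]
    have hk : k ≤ ∑ i, (c i).size := by
      calc k = ∑ _i : Fin k, 1 := by simp
        _ ≤ _ := Finset.sum_le_sum fun i _ => pos (c i)
    refine Set.mem_iUnion.2 ⟨⟨k, by omega⟩, c, fun i => ?_, rfl⟩
    have := Finset.single_le_sum (f := fun i => (c i).size) (fun i _ => Nat.zero_le _)
      (Finset.mem_univ i)
    simp only [Set.mem_ofPred_eq]
    omega

noncomputable instance (n : ℕ) : Fintype {t : OrderedTree // t.size = n} :=
  ((finite_size_le n).subset fun _ h => le_of_eq h).fintype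

/-- The expected degree of the root of a uniformly random ordered tree with `n` nodes. -/
noncomputable def avgRootDegree (n : ℕ) : ℝ :=
  (∑ t : {t : OrderedTree // t.size = n}, (t.1.rootDegree : ℝ)) /
    Fintype.card {t : OrderedTree // t.size = n}

end OrderedTree

namespace DistTree

/-- The number of nodes. -/
def size : DistTree → ℕ
  | leaf => 1
  | node _ _ child => 1 + ∑ i, (child i).size

/-- The number of children of the root. -/
def rootDegree : DistTree → ℕ
  | leaf => 0
  | node k _ _ => k + 1

theorem finite_size_le (n : ℕ) : {t : DistTree | t.size ≤ n}.Finite := by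
  have pos : ∀ t : DistTree, 1 ≤ t.size := by
    intro t
    cases t <;> simp [size]
  induction n with
  | zero =>
    refine Set.Finite.subset Set.finite_empty ?_
    intro t h
    have := pos t
    simp only [Set.mem_ofPred_eq] at h
    omega
  | succ n ih =>
    refine Set.Finite.subset ((Set.finite_singleton DistTree.leaf).union
      (Set.finite_iUnion (fun k : Fin n => Set.finite_iUnion (fun d : Fin ((k : ℕ) + 1) =>
      (Set.Finite.pi' (fun _ : Fin ((k : ℕ) + 1) => ih)).image (DistTree.node k d))))) ?_
    rintro (_ | ⟨k, d, c⟩) h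
    · exact Or.inl rfl
    simp only [Set.mem_ofPred_eq, size] at h
    have hk : k + 1 ≤ ∑ i, (c i).size := by
      calc k + 1 = ∑ _i : Fin (k + 1), 1 := by simp
        _ ≤ _ := Finset.sum_le_sum fun i _ => pos (c i)
    refine Or.inr (Set.mem_iUnion.2 ⟨⟨k, by omega⟩, Set.mem_iUnion.2 ⟨d, c, fun i => ?_, rfl⟩⟩)
    have := Finset.single_le_sum (f := fun i => (c i).size) (fun i _ => Nat.zero_le _)
      (Finset.mem_univ i)
    simp only [Set.mem_ofPred_eq]
    omega

noncomputable instance (n : ℕ) : Fintype {t : DistTree // t.size = n} :=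
  ((finite_size_le n).subset fun _ h => le_of_eq h).fintype

/-- The expected degree of the root of a uniformly random tree with distinguished children and
`n` nodes. -/
noncomputable def avgRootDegree (n : ℕ) : ℝ :=
  (∑ t : {t : DistTree // t.size = n}, (t.1.rootDegree : ℝ)) /
    Fintype.card {t : DistTree // t.size = n}

/-- The generating function `A(z)`, where `z` marks the number of nodes. -/
noncomputable def genFun : PowerSeries ℤ :=
  PowerSeries.mk fun n => (Fintype.card {t : DistTree // t.size = n} : ℤ)

/-- The generating function `F(z, w)`, where `z` marks the number of nodes and `w` (the variable of
the coefficient polynomials) marks the degree of the root. -/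
noncomputable def rootGenFun : PowerSeries (Polynomial ℤ) :=
  PowerSeries.mk fun n => ∑ t : {t : DistTree // t.size = n}, Polynomial.X ^ t.1.rootDegree

/-- The power series `∂F/∂w (z, 1)`. -/
noncomputable def rootGenFunDeriv : PowerSeries ℤ :=
  PowerSeries.mk fun n => (Polynomial.derivative (PowerSeries.coeff n rootGenFun)).eval 1

end DistTree

/-! Removing the root turns a tree with root degree `j` into a `j`-tuple of trees, with `j` choices
of distinguished child (one choice for a leaf). Hence `A = z φ(A)` and `F = z φ(w A)` with `φ(u) = 1
+ ∑ j u ^ j = 1 + u / (1 - u) ^ 2`, and differentiating at `w = 1` gives `D = z G(A)` with `G(u) = u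
φ'(u) = ∑ j ^ 2 u ^ j`.

Lagrange inversion, `(n + 1) [z ^ (n + 1)] H(A) = [u ^ n] H'(u) φ(u) ^ (n + 1)`, expresses the
coefficients of `A` (`H = u`) and of `D` (`H = G`) through large powers of `φ`. Cauchy's formula on
the circle of radius `τ`, where `φ(τ) = τ φ'(τ)`, and Laplace's method give `[u ^ n] h φ ^ (n + 1) ~
κ h(τ) φ(τ) ^ (n + 1) / (τ ^ n √(n + 1))`, with `κ ≠ 0` independent of `h`. In the quotient `κ`
cancels. The extra factor `z` in `D` shifts the index by one and leaves `ρ = τ / φ(τ)`, so the limit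
is `ρ G'(τ)`.

Ordered trees are handled exactly: they are counted by Catalan numbers, and the mean root degree
with `n + 1` nodes is `C_(n+1) / C_n - 1`, which tends to `4 - 1`. -/

/-! ### Counting trees by tuples of subtrees -/

theorem finite_tuple_sum_eq {T : Type*} (s : T → ℕ) (h : ∀ n, Finite {t // s t = n}) (k n : ℕ) :
    Finite {c : Fin k → T // ∑ i, s (c i) = n} := by
  have hle : {t | s t ≤ n}.Finite := by
    have : {t | s t ≤ n} = ⋃ m : Fin (n + 1), {t | s t = m} := by
      ext t
      simp only [Set.mem_ofPred_eq, Set.mem_iUnion]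
      exact ⟨fun ht => ⟨⟨s t, by omega⟩, rfl⟩, fun ⟨m, hm⟩ => by omega⟩
    rw [this]
    exact Set.finite_iUnion fun m => h m
  refine Set.Finite.subset (Set.Finite.pi' (fun _ : Fin k => hle)) ?_
  intro c hc i
  have := Finset.single_le_sum (f := fun i => s (c i)) (fun i _ => Nat.zero_le _)
    (Finset.mem_univ i)
  exact this.trans (le_of_eq hc)

/-- Tuples of total size `n` are counted by the powers of the generating function. -/
theorem mk_card_pow {T : Type*} (s : T → ℕ) (h : ∀ n, Finite {t // s t = n}) (k : ℕ) :
    (PowerSeries.mk fun n => (Nat.card {t // s t = n} : ℤ)) ^ k =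
      PowerSeries.mk fun n => (Nat.card {c : Fin k → T // ∑ i, s (c i) = n} : ℤ) := by
  induction k with
  | zero =>
    ext n
    rw [pow_zero, PowerSeries.coeff_one, PowerSeries.coeff_mk]
    by_cases hn : n = 0
    · subst hn
      simp
    · rw [if_neg hn, eq_comm, Nat.cast_eq_zero, Nat.card_eq_zero]
      left
      constructor
      rintro ⟨c, hc⟩
      simp at hc
      exact hn hc.symm
  | succ k ih =>
    ext n
    rw [pow_succ', ih, PowerSeries.coeff_mul, PowerSeries.coeff_mk]
    simp only [PowerSeries.coeff_mk]
    let f : (Σ p : Finset.HasAntidiagonal.antidiagonal n,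
        {t // s t = p.1.1} × {c : Fin k → T // ∑ i, s (c i) = p.1.2}) →
        {c : Fin (k + 1) → T // ∑ i, s (c i) = n} := fun x =>
      ⟨Fin.cons x.2.1.1 x.2.2.1, by
        rw [Fin.sum_univ_succ]
        simp only [Fin.cons_zero, Fin.cons_succ]
        rw [x.2.1.2, x.2.2.2]
        exact Finset.HasAntidiagonal.mem_antidiagonal.1 x.1.2⟩
    have hf : Function.Bijective f := by
      constructor
      · rintro ⟨⟨⟨a, b⟩, hp⟩, ⟨t, ht⟩, ⟨c, hc⟩⟩ ⟨⟨⟨a', b'⟩, hp'⟩, ⟨t', ht'⟩, ⟨c', hc'⟩⟩ he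
        obtain ⟨h1, h2⟩ : t = t' ∧ c = c' :=
          Fin.cons_inj (α := fun _ => T) |>.1 (congrArg Subtype.val he)
        clear he
        subst h1 h2
        simp only at ht ht' hc hc'
        subst ht hc ht' hc'
        rfl
      · rintro ⟨c, hc⟩
        rw [Fin.sum_univ_succ] at hc
        refine ⟨⟨⟨(s (c 0), ∑ i : Fin k, s (c i.succ)), Finset.HasAntidiagonal.mem_antidiagonal.2 hc⟩,
          ⟨c 0, rfl⟩, ⟨fun i => c i.succ, rfl⟩⟩, Subtype.ext ?_⟩
        exact Fin.cons_self_tail c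
    have := h
    have := fun k n => finite_tuple_sum_eq s h k n
    rw [← Nat.card_congr (Equiv.ofBijective f hf), Nat.card_sigma]
    push_cast
    simp only [Nat.card_prod]
    push_cast
    rw [Finset.sum_coe_sort (Finset.HasAntidiagonal.antidiagonal n) (fun p => (Nat.card {t // s t = p.1} : ℤ) *
      (Nat.card {c : Fin k → T // ∑ i, s (c i) = p.2} : ℤ))]

theorem coeff_pow_eq_zero_of_lt {R : Type*} [CommRing R] {b : PowerSeries R}
    (hb : PowerSeries.constantCoeff b = 0) {n j : ℕ} (h : n < j) :
    PowerSeries.coeff n (b ^ j) = 0 := by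
  obtain ⟨c, rfl⟩ := PowerSeries.X_dvd_iff.2 hb
  rw [mul_pow, PowerSeries.coeff_X_pow_mul', if_neg (by omega)]

/-- `b ^ j` starts in degree at least `j`, so composition is a finite sum in each degree. This is
the shape in which sums over trees appear. -/
theorem coeff_subst_eq_sum_range {R S : Type*} [CommRing R] [CommRing S] [Algebra R S]
    {b : PowerSeries S} (hb : PowerSeries.constantCoeff b = 0) (f : PowerSeries R) (n : ℕ) :
    PowerSeries.coeff n (f.subst b) =
      ∑ j ∈ Finset.range (n + 1), PowerSeries.coeff j f • PowerSeries.coeff n (b ^ j) := by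
  rw [PowerSeries.coeff_subst' (PowerSeries.HasSubst.of_constantCoeff_zero' hb)]
  apply finsum_eq_sum_of_support_subset
  intro j hj
  by_contra hj'
  apply hj
  simp only [Finset.coe_range, Set.mem_Iio, not_lt] at hj'
  simp only
  rw [coeff_pow_eq_zero_of_lt hb (by omega), smul_zero]

/-- If the elements of size `n + 1` and degree `j` are counted by `weight j` times the tuples of
length `j` and total size `n`, a sum over elements of size `n + 1` is a weighted sum of powers. -/
theorem sum_degree_eq {T R : Type*} [CommRing R] (s deg : T → ℕ) (weight : ℕ → ℕ)
    [∀ n, Fintype {t // s t = n}] (n : ℕ)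
    (hdeg : ∀ t, s t = n + 1 → deg t ≤ n)
    (hcard : ∀ j, Nat.card {t : {t // s t = n + 1} // deg t.1 = j} =
      weight j * Nat.card {c : Fin j → T // ∑ i, s (c i) = n}) (g : ℕ → R) :
    ∑ t : {t // s t = n + 1}, g (deg t.1) =
      ∑ j ∈ Finset.range (n + 1), (weight j : R) * g j *
        ((PowerSeries.coeff n ((PowerSeries.mk fun n => (Fintype.card {t // s t = n} : ℤ)) ^ j) :
          ℤ) : R) := by
  rw [← Finset.sum_fiberwise_of_maps_to (t := Finset.range (n + 1))
    (g := fun t : {t // s t = n + 1} => deg t.1)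
    (fun t _ => Finset.mem_range.2 (Nat.lt_succ_of_le (hdeg t.1 t.2)))]
  refine Finset.sum_congr rfl fun j _ => ?_
  have h1 : (PowerSeries.mk fun n => (Fintype.card {t // s t = n} : ℤ)) =
      PowerSeries.mk fun n => (Nat.card {t // s t = n} : ℤ) := by
    simp only [Nat.card_eq_fintype_card]
  rw [h1, mk_card_pow s (fun n => inferInstance), PowerSeries.coeff_mk,
    Finset.sum_congr rfl (g := fun _ => g j) (fun t ht => by rw [(Finset.mem_filter.1 ht).2]),
    Finset.sum_const, nsmul_eq_mul, ← Fintype.card_subtype, ← Nat.card_eq_fintype_card, hcard]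
  push_cast
  ring

theorem le_sum_of_one_le {T : Type*} (s : T → ℕ) (h : ∀ t, 1 ≤ s t) {k : ℕ} (c : Fin k → T) :
    k ≤ ∑ i, s (c i) := by
  calc k = ∑ _i : Fin k, 1 := by simp
    _ ≤ _ := Finset.sum_le_sum fun i _ => h (c i)

/-! ### Functional equations for trees with distinguished children -/

namespace DistTree

theorem one_le_size (t : DistTree) : 1 ≤ t.size := by
  cases t <;> simp [size]

/-- The number of ways to distinguish one of `j` children, with the convention for leaves. -/
def weight (j : ℕ) : ℕ := if j = 0 then 1 else j

theorem card_size_rootDegree (n j : ℕ) :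
    Nat.card {t : {t : DistTree // t.size = n + 1} // t.1.rootDegree = j} =
      weight j * Nat.card {c : Fin j → DistTree // ∑ i, (c i).size = n} := by
  rcases j with _ | k
  · have e : {t : {t : DistTree // t.size = n + 1} // t.1.rootDegree = 0} ≃
        {c : Fin 0 → DistTree // ∑ i, (c i).size = n} :=
      { toFun := fun t => ⟨Fin.elim0, by
          obtain ⟨⟨_ | ⟨k, d, c⟩, h⟩, h0⟩ := t
          · simp [size] at h
            simp [h]
          · simp [rootDegree] at h0⟩
        invFun := fun c => ⟨⟨leaf, by
          have := c.2
          simp at this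
          simp [size, ← this]⟩, rfl⟩
        left_inv := by
          rintro ⟨⟨_ | ⟨k, d, c⟩, h⟩, h0⟩
          · rfl
          · simp [rootDegree] at h0
        right_inv := fun c => Subsingleton.elim _ _ }
    rw [Nat.card_congr e, weight, if_pos rfl, one_mul]
  · let f : Fin (k + 1) × {c : Fin (k + 1) → DistTree // ∑ i, (c i).size = n} →
        {t : {t : DistTree // t.size = n + 1} // t.1.rootDegree = k + 1} := fun x =>
      ⟨⟨node k x.1 x.2.1, by rw [size, x.2.2, add_comm]⟩, rfl⟩
    have hf : Function.Bijective f := by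
      constructor
      · rintro ⟨d, c, hc⟩ ⟨d', c', hc'⟩ he
        have := congrArg (fun t => t.1.1) he
        simp only [f, node.injEq, heq_eq_eq, true_and] at this
        obtain ⟨rfl, rfl⟩ := this
        rfl
      · rintro ⟨⟨_ | ⟨k', d, c⟩, h⟩, h0⟩
        · simp [rootDegree] at h0
        · simp only [rootDegree, Nat.add_right_cancel_iff] at h0
          subst h0
          exact ⟨(d, ⟨c, by rw [size] at h; omega⟩), rfl⟩
    rw [← Nat.card_congr (Equiv.ofBijective f hf), Nat.card_prod]
    simp [weight]

/-- One count serves three series: `g = 1` yields `A`, `g j = X ^ j` yields `F`, and `g j = j`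
yields `D`. -/
theorem sum_rootDegree_eq {R : Type*} [CommRing R] (g : ℕ → R) (n : ℕ) :
    ∑ t : {t : DistTree // t.size = n + 1}, g t.1.rootDegree =
      ∑ j ∈ Finset.range (n + 1), (weight j : R) * g j *
        ((PowerSeries.coeff n (genFun ^ j) : ℤ) : R) := by
  refine sum_degree_eq size rootDegree weight n ?_ (card_size_rootDegree n) g
  rintro (_ | ⟨k, d, c⟩) h
  · exact Nat.zero_le _
  · rw [size] at h
    have := le_sum_of_one_le size one_le_size c
    simp only [rootDegree]
    omega

instance isEmpty_size_zero : IsEmpty {t : DistTree // t.size = 0} :=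
  ⟨fun t => by have := one_le_size t.1; have := t.2; omega⟩

theorem constantCoeff_genFun : PowerSeries.constantCoeff genFun = 0 := by
  rw [← PowerSeries.coeff_zero_eq_constantCoeff_apply, genFun, PowerSeries.coeff_mk]
  simp

/-- The generating function of the weights, `1 + u / (1 - u) ^ 2`. -/
noncomputable def weightSeries : PowerSeries ℤ := PowerSeries.mk fun j => (weight j : ℤ)

theorem constantCoeff_map_genFun {R : Type*} [CommRing R] (f : ℤ →+* R) :
    PowerSeries.constantCoeff (PowerSeries.map f genFun) = 0 := by
  rw [← PowerSeries.coeff_zero_eq_constantCoeff_apply, PowerSeries.coeff_map,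
    PowerSeries.coeff_zero_eq_constantCoeff_apply, constantCoeff_genFun, map_zero]

theorem genFun_eq : genFun = PowerSeries.X * weightSeries.subst genFun := by
  ext (_ | n)
  · simp [constantCoeff_genFun]
  · rw [PowerSeries.coeff_succ_X_mul, coeff_subst_eq_sum_range constantCoeff_genFun]
    have := sum_rootDegree_eq (R := ℤ) (fun _ => 1) n
    simp only [Finset.sum_const, Finset.card_univ, nsmul_eq_mul, mul_one] at this
    rw [genFun, PowerSeries.coeff_mk]
    refine this.trans (Finset.sum_congr rfl fun j _ => ?_)
    rw [weightSeries, PowerSeries.coeff_mk, smul_eq_mul]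
    rfl

theorem rootGenFun_eq : rootGenFun = PowerSeries.X *
    weightSeries.subst (PowerSeries.C Polynomial.X * PowerSeries.map Polynomial.C genFun) := by
  have h0 : PowerSeries.constantCoeff
      (PowerSeries.C (Polynomial.X : Polynomial ℤ) * PowerSeries.map Polynomial.C genFun) = 0 := by
    rw [map_mul, constantCoeff_map_genFun, mul_zero]
  ext1 (_ | n)
  · simp [rootGenFun]
  · rw [PowerSeries.coeff_succ_X_mul, coeff_subst_eq_sum_range h0, rootGenFun,
      PowerSeries.coeff_mk, sum_rootDegree_eq (fun j => (Polynomial.X : Polynomial ℤ) ^ j) n]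
    refine Finset.sum_congr rfl fun j _ => ?_
    rw [mul_pow, ← map_pow, ← map_pow, PowerSeries.coeff_C_mul, PowerSeries.coeff_map,
      zsmul_eq_mul]
    simp [weightSeries, mul_assoc]

theorem coeff_rootGenFunDeriv (n : ℕ) : PowerSeries.coeff n rootGenFunDeriv =
    ∑ t : {t : DistTree // t.size = n}, (t.1.rootDegree : ℤ) := by
  simp [rootGenFunDeriv, rootGenFun, Polynomial.eval_finsetSum, Polynomial.derivative_X_pow]

theorem rootGenFunDeriv_eq : rootGenFunDeriv = PowerSeries.X *
    (PowerSeries.X * PowerSeries.derivative ℤ weightSeries).subst genFun := by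
  ext (_ | n)
  · rw [coeff_rootGenFunDeriv]
    simp
  · rw [PowerSeries.coeff_succ_X_mul, coeff_subst_eq_sum_range constantCoeff_genFun,
      coeff_rootGenFunDeriv, sum_rootDegree_eq (fun j => (j : ℤ)) n]
    refine Finset.sum_congr rfl fun j _ => ?_
    rcases j with _ | j
    · simp
    · rw [PowerSeries.coeff_succ_X_mul, PowerSeries.coeff_derivative]
      simp [weightSeries]

theorem weightSeries_mul :
    weightSeries * (1 - PowerSeries.X) ^ 2 = (1 - PowerSeries.X) ^ 2 + PowerSeries.X := by
  -- The series multiplied by `X` is `1 / (1 - X) ^ 2`, which `h2` verifies.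
  have h : weightSeries = 1 + PowerSeries.X * (PowerSeries.mk fun n => ((n + 1 : ℕ) : ℤ)) := by
    ext (_ | n)
    · simp [weightSeries, weight]
    · simp [weightSeries, weight, PowerSeries.coeff_one, PowerSeries.coeff_succ_X_mul]
  have h2 : (PowerSeries.mk fun n => ((n + 1 : ℕ) : ℤ)) * (1 - PowerSeries.X) ^ 2 = 1 := by
    have h3 : (PowerSeries.mk fun n => ((n + 1 : ℕ) : ℤ)) * (1 - PowerSeries.X) =
        PowerSeries.mk 1 := by
      ext (_ | n)
      · simp [mul_sub]
      · rw [mul_sub, mul_one, map_sub, PowerSeries.coeff_succ_mul_X]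
        simp
    rw [pow_two, ← mul_assoc, h3, PowerSeries.mk_one_mul_one_sub_eq_one]
  rw [h]
  linear_combination (PowerSeries.X : PowerSeries ℤ) * h2

/-- Substitution is an algebra homomorphism, so the rational identity for `weightSeries`, with
denominators cleared, passes to the composite. -/
theorem rootGenFun_mul (w A : PowerSeries (Polynomial ℤ)) (hw : w = PowerSeries.C Polynomial.X)
    (hA : A = PowerSeries.map Polynomial.C genFun) :
    rootGenFun * (1 - w * A) ^ 2 =
      PowerSeries.X * (1 - w * A) ^ 2 + PowerSeries.X * (w * A) := by
  have h0 : PowerSeries.HasSubst (w * A) := by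
    apply PowerSeries.HasSubst.of_constantCoeff_zero'
    rw [hA, map_mul, constantCoeff_map_genFun, mul_zero]
  have h := congrArg (PowerSeries.substAlgHom h0) weightSeries_mul
  simp only [map_mul, map_add, map_pow, map_sub, map_one, PowerSeries.substAlgHom_X] at h
  rw [PowerSeries.coe_substAlgHom] at h
  rw [rootGenFun_eq, ← hw, ← hA]
  linear_combination (PowerSeries.X : PowerSeries (Polynomial ℤ)) * h

/-- The series `∑ j ^ 2 u ^ j`. -/
noncomputable def degreeSeries : PowerSeries ℤ :=
  PowerSeries.X * PowerSeries.derivative ℤ weightSeries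

/-- Differentiating `weightSeries_mul` and multiplying by `X * (1 - X)` leaves a term in
`weightSeries` itself, which a second use of `weightSeries_mul` removes. -/
theorem degreeSeries_mul : degreeSeries * (1 - PowerSeries.X) ^ 3 =
    PowerSeries.X * (1 + PowerSeries.X) := by
  have h := congrArg (PowerSeries.derivative ℤ) weightSeries_mul
  simp only [Derivation.leibniz, map_add, map_sub, Derivation.leibniz_pow, Derivation.map_one_eq_zero,
    PowerSeries.derivative_X, smul_eq_mul, nsmul_eq_mul] at h
  rw [degreeSeries]
  push_cast at h
  linear_combination (PowerSeries.X : PowerSeries ℤ) * (1 - PowerSeries.X) * h +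
    2 * (PowerSeries.X : PowerSeries ℤ) * weightSeries_mul

theorem derivative_degreeSeries_mul :
    PowerSeries.derivative ℤ degreeSeries * (1 - PowerSeries.X) ^ 4 =
      1 + 4 * PowerSeries.X + PowerSeries.X ^ 2 := by
  have h := congrArg (PowerSeries.derivative ℤ) degreeSeries_mul
  simp only [Derivation.leibniz, map_add, map_sub, Derivation.leibniz_pow, Derivation.map_one_eq_zero,
    PowerSeries.derivative_X, smul_eq_mul, nsmul_eq_mul] at h
  push_cast at h
  linear_combination (1 - PowerSeries.X : PowerSeries ℤ) * h + 3 * degreeSeries_mul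

theorem rootGenFunDeriv_mul : rootGenFunDeriv * (1 - genFun) ^ 3 =
    PowerSeries.X * genFun * (genFun + 1) := by
  have h0 : PowerSeries.HasSubst genFun :=
    PowerSeries.HasSubst.of_constantCoeff_zero' constantCoeff_genFun
  have h := congrArg (PowerSeries.substAlgHom h0) degreeSeries_mul
  simp only [map_mul, map_add, map_pow, map_sub, map_one, PowerSeries.substAlgHom_X] at h
  rw [PowerSeries.coe_substAlgHom] at h
  rw [rootGenFunDeriv_eq, ← degreeSeries]
  linear_combination (PowerSeries.X : PowerSeries ℤ) * h

theorem avgRootDegree_eq (n : ℕ) : avgRootDegree n =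
    ((PowerSeries.coeff n rootGenFunDeriv : ℤ) : ℝ) / ((PowerSeries.coeff n genFun : ℤ) : ℝ) := by
  rw [coeff_rootGenFunDeriv, genFun, PowerSeries.coeff_mk, avgRootDegree]
  push_cast
  rfl

end DistTree

/-! ### Lagrange inversion -/

namespace PowerSeries

/-- A solution of `A = X * φ(A)` has `X / φ` as its compositional inverse on both sides. -/
theorem subst_X_mul_inv_of_eq {K : Type*} [Field K] {φ A : PowerSeries K}
    (hφ : constantCoeff φ ≠ 0) (hA0 : constantCoeff A = 0) (hA : A = X * φ.subst A) :
    A.subst (X * φ⁻¹) = X := by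
  have hs : HasSubst A := HasSubst.of_constantCoeff_zero' hA0
  set f : PowerSeries K := X * φ⁻¹ with hf
  have hf0 : constantCoeff f = 0 := by simp [hf]
  have hfs : HasSubst f := HasSubst.of_constantCoeff_zero' hf0
  have hfφ : f * φ = X := by rw [hf, mul_assoc, PowerSeries.inv_mul_cancel _ hφ, mul_one]
  have h1 : f.subst A * φ.subst A = X * φ.subst A := by
    rw [← subst_mul hs, hfφ, subst_X hs]
    exact hA
  have hφA : φ.subst A ≠ 0 := by
    intro h
    have h2 : φ.subst A * (φ⁻¹).subst A = 1 := by
      rw [← subst_mul hs, PowerSeries.mul_inv_cancel _ hφ, ← coe_substAlgHom hs, map_one]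
    rw [h, zero_mul] at h2
    exact zero_ne_one h2
  have h3 : f.subst A = X := mul_right_cancel₀ hφA h1
  have hu : IsUnit (coeff 1 f) := by
    rw [hf, coeff_succ_X_mul, coeff_zero_eq_constantCoeff_apply, isUnit_iff_ne_zero]
    simpa using hφ
  have hg := constantCoeff_substInvOfIsUnit f hu
  -- `A` inverts `f` on one side and `substInvOfIsUnit` on the other, so associativity of
  -- substitution identifies them.
  have h4 : (f.substInvOfIsUnit hu) = A := by
    have := subst_comp_subst_apply (R := K) hfs hs (f.substInvOfIsUnit hu)
    rw [subst_substInvOfIsUnit_left f hf0 hu, subst_X hs, h3, X_subst] at this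
    exact this.symm
  rw [← h4, subst_substInvOfIsUnit_left f hf0 hu]

/-- The derivatives of the powers of `X / φ` are dual to the powers of `φ`. -/
theorem coeff_derivative_X_mul_inv_pow_mul {K : Type*} [Field K] [CharZero K] {φ : PowerSeries K}
    (hφ : constantCoeff φ ≠ 0) (m n : ℕ) :
    coeff n (derivative K ((X * φ⁻¹) ^ m) * φ ^ (n + 1)) = if m = n + 1 then (n + 1 : K) else 0 := by
  have hi : φ⁻¹ * φ = 1 := PowerSeries.inv_mul_cancel _ hφ
  have hd : derivative K (X * φ⁻¹) * φ ^ 2 = φ - X * derivative K φ := by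
    rw [Derivation.leibniz, derivative_inv', derivative_X, smul_eq_mul, smul_eq_mul]
    linear_combination (-X * derivative K φ * (φ⁻¹ * φ + 1) + φ) * hi
  rcases m with _ | m
  · simp
  rw [Derivation.leibniz_pow, Nat.add_sub_cancel, smul_eq_mul, nsmul_eq_mul, mul_pow]
  rcases lt_trichotomy m n with h | h | h
  -- Here the coefficient is a multiple of that of `X ^ (k + 1)` in `φ ^ (k + 1) - X φ ^ k φ'`. It
  -- vanishes because `(φ ^ (k + 1))' = (k + 1) φ ^ k φ'`; the division by `k + 1` needs
  -- characteristic zero.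
  · obtain ⟨k, rfl⟩ := Nat.exists_eq_add_of_lt h
    rw [if_neg (by omega)]
    have e1 : (((m + 1 : ℕ) : PowerSeries K) * (X ^ m * φ⁻¹ ^ m * derivative K (X * φ⁻¹))) * φ ^ (m + k + 1 + 1) =
        ((m + 1 : ℕ) : PowerSeries K) * (X ^ m * (φ ^ (k + 1) - X * (φ ^ k * derivative K φ))) := by
      have : φ⁻¹ ^ m * φ ^ m = 1 := by rw [← mul_pow, hi, one_pow]
      linear_combination (((m + 1 : ℕ) : PowerSeries K) * X ^ m * derivative K (X * φ⁻¹) * φ ^ (k + 2)) * this +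
        (((m + 1 : ℕ) : PowerSeries K) * X ^ m * φ ^ k) * hd
    rw [e1, ← nsmul_eq_mul, map_nsmul, show m + k + 1 = k + 1 + m by ring, coeff_X_pow_mul,
      map_sub, coeff_succ_X_mul]
    have e2 := congrArg (coeff k) (Derivation.leibniz_pow (derivative K) φ (k + 1))
    rw [coeff_derivative, Nat.add_sub_cancel, map_nsmul, smul_eq_mul, nsmul_eq_mul] at e2
    have hk : (k + 1 : K) ≠ 0 := by exact_mod_cast Nat.succ_ne_zero k
    have e3 : coeff (k + 1) (φ ^ (k + 1)) = coeff k (φ ^ k * derivative K φ) := by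
      apply mul_right_cancel₀ hk
      rw [e2]
      push_cast
      ring
    rw [e3, sub_self, smul_zero]
  · subst h
    rw [if_pos rfl]
    have e1 : (((m + 1 : ℕ) : PowerSeries K) * (X ^ m * φ⁻¹ ^ m * derivative K (X * φ⁻¹))) * φ ^ (m + 1) =
        ((m + 1 : ℕ) : PowerSeries K) * (X ^ m * (1 - X * (φ⁻¹ * derivative K φ))) := by
      have : φ⁻¹ ^ m * φ ^ m = 1 := by rw [← mul_pow, hi, one_pow]
      have hd' : derivative K (X * φ⁻¹) * φ = 1 - X * (φ⁻¹ * derivative K φ) := by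
        linear_combination φ⁻¹ * hd + (1 - derivative K (X * φ⁻¹) * φ) * hi
      linear_combination (((m + 1 : ℕ) : PowerSeries K) * X ^ m * derivative K (X * φ⁻¹) * φ) * this +
        (((m + 1 : ℕ) : PowerSeries K) * X ^ m) * hd'
    rw [e1, ← nsmul_eq_mul, map_nsmul]
    have := coeff_X_pow_mul (1 - X * (φ⁻¹ * derivative K φ)) m 0
    rw [zero_add] at this
    rw [this]
    simp
  · rw [if_neg (by omega)]
    rw [show ((m + 1 : ℕ) : PowerSeries K) * (X ^ m * φ⁻¹ ^ m * derivative K (X * φ⁻¹)) *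
      φ ^ (n + 1) = X ^ m * (((m + 1 : ℕ) : PowerSeries K) *
        (φ⁻¹ ^ m * derivative K (X * φ⁻¹)) * φ ^ (n + 1)) by ring,
      coeff_X_pow_mul', if_neg (by omega)]

/-- **Lagrange inversion** for the solution of `A = X * φ(A)`. -/
theorem coeff_subst_of_eq_X_mul_subst {K : Type*} [Field K] [CharZero K] {φ A : PowerSeries K}
    (hφ : constantCoeff φ ≠ 0) (hA0 : constantCoeff A = 0) (hA : A = X * φ.subst A)
    (H : PowerSeries K) (n : ℕ) :
    (n + 1 : K) * coeff (n + 1) (H.subst A) = coeff n (derivative K H * φ ^ (n + 1)) := by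
  have hs : HasSubst A := HasSubst.of_constantCoeff_zero' hA0
  have hfs : HasSubst (X * φ⁻¹) := HasSubst.of_constantCoeff_zero' (by simp)
  obtain ⟨P, hP⟩ : ∃ P : PowerSeries K, P = H.subst A := ⟨_, rfl⟩
  have hH : H = P.subst (X * φ⁻¹) := by
    rw [hP, subst_comp_subst_apply hs hfs, subst_X_mul_inv_of_eq hφ hA0 hA, X_subst]
  -- `H` is `P` evaluated at `X / φ`. The terms from `n + 2` on are divisible by `X ^ (n + 2)`,
  -- their derivative by `X ^ (n + 1)`, so they do not reach coefficient `n`; duality then selects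
  -- `j = n + 1` from a finite sum.
  have hsplit : H = (X * φ⁻¹) ^ (n + 2) * (mk fun i => coeff (i + (n + 2)) P).subst (X * φ⁻¹) +
      ∑ j ∈ Finset.range (n + 2), coeff j P • (X * φ⁻¹) ^ j := by
    have h1 : P = X ^ (n + 2) * (mk fun i => coeff (i + (n + 2)) P) +
        ∑ j ∈ Finset.range (n + 2), coeff j P • X ^ j := by
      conv_lhs => rw [eq_X_pow_mul_shift_add_trunc (n + 2) P]
      congr 1
      ext i
      simp [Polynomial.coeff_coe, coeff_trunc, coeff_X_pow]
    have h2 := congrArg (substAlgHom hfs) h1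
    simp only [map_add, map_mul, map_pow, map_sum, map_smul, substAlgHom_X] at h2
    rw [coe_substAlgHom] at h2
    rw [hH]
    exact h2
  rw [← hP]
  conv_rhs => rw [hsplit]
  rw [map_add (derivative K), add_mul (derivative K _), map_add (coeff n), map_sum, Finset.sum_mul,
    map_sum]
  have h0 : coeff n (derivative K ((X * φ⁻¹) ^ (n + 2) *
      (mk fun i => coeff (i + (n + 2)) P).subst (X * φ⁻¹)) * φ ^ (n + 1)) = 0 := by
    apply X_pow_dvd_iff.1 _ n (Nat.lt_succ_self n)
    apply Dvd.dvd.mul_right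
    rw [Derivation.leibniz, Derivation.leibniz_pow, smul_eq_mul, smul_eq_mul, nsmul_eq_mul,
      smul_eq_mul, show n + 2 - 1 = n + 1 by omega, mul_pow, mul_pow]
    refine dvd_add ?_ ?_
    · exact ((pow_dvd_pow X (by omega)).mul_right _).mul_right _
    · exact (((dvd_refl _).mul_right _).mul_right _).mul_left _ |>.mul_left _
  rw [h0, zero_add, Finset.sum_eq_single (n + 1)]
  · rw [Derivation.map_smul, smul_mul_assoc, map_smul, coeff_derivative_X_mul_inv_pow_mul hφ,
      if_pos rfl, smul_eq_mul, mul_comm]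
  · intro j _ hj
    rw [Derivation.map_smul, smul_mul_assoc, map_smul, coeff_derivative_X_mul_inv_pow_mul hφ,
      if_neg hj, smul_zero]
  · intro h
    simp at h

end PowerSeries

/-! ### Evaluation of power series, Cauchy's formula and Laplace's method -/

open scoped Real

/-- The power series `P` converges absolutely at `u` with sum `a`. -/
def EvalsTo (P : PowerSeries ℂ) (u a : ℂ) : Prop :=
  (Summable fun j => ‖PowerSeries.coeff j P * u ^ j‖) ∧
    HasSum (fun j => PowerSeries.coeff j P * u ^ j) a

namespace EvalsTo

theorem mul {P Q : PowerSeries ℂ} {u a b : ℂ} (hP : EvalsTo P u a) (hQ : EvalsTo Q u b) :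
    EvalsTo (P * Q) u (a * b) := by
  have h : (fun n => PowerSeries.coeff n (P * Q) * u ^ n) = fun n =>
      ∑ kl ∈ Finset.HasAntidiagonal.antidiagonal n,
        (PowerSeries.coeff kl.1 P * u ^ kl.1) * (PowerSeries.coeff kl.2 Q * u ^ kl.2) := by
    ext n
    rw [PowerSeries.coeff_mul, Finset.sum_mul]
    refine Finset.sum_congr rfl fun p hp => ?_
    rw [← Finset.HasAntidiagonal.mem_antidiagonal.1 hp, pow_add]
    ring
  have h1 := summable_norm_sum_mul_antidiagonal_of_summable_norm hP.1 hQ.1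
  refine ⟨h1.congr fun n => by rw [← congrFun h n], ?_⟩
  have h2 := tsum_mul_tsum_eq_tsum_sum_antidiagonal_of_summable_norm hP.1 hQ.1
  rw [hP.2.tsum_eq, hQ.2.tsum_eq] at h2
  rw [h, h2]
  exact h1.of_norm.hasSum

theorem coe (p : Polynomial ℂ) (u : ℂ) : EvalsTo (p : PowerSeries ℂ) u (p.eval u) := by
  have h : ∀ j ∉ p.support, PowerSeries.coeff j (p : PowerSeries ℂ) * u ^ j = 0 := by
    intro j hj
    rw [Polynomial.coeff_coe, Polynomial.notMem_support_iff.1 hj, zero_mul]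
  refine ⟨summable_of_ne_finset_zero (s := p.support) fun j hj => by rw [h j hj, norm_zero], ?_⟩
  rw [Polynomial.eval_eq_sum, Polynomial.sum]
  simp only [Polynomial.coeff_coe] at h ⊢
  exact hasSum_sum_of_ne_finset_zero h

theorem one (u : ℂ) : EvalsTo 1 u 1 := by
  simpa using coe 1 u

theorem pow {P : PowerSeries ℂ} {u a : ℂ} (hP : EvalsTo P u a) (n : ℕ) :
    EvalsTo (P ^ n) u (a ^ n) := by
  induction n with
  | zero => simpa using one u
  | succ n ih => simpa [pow_succ] using ih.mul hP

theorem unique {P : PowerSeries ℂ} {u a b : ℂ} (ha : EvalsTo P u a) (hb : EvalsTo P u b) :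
    a = b := ha.2.unique hb.2

/-- The sum of an absolutely convergent series that is a quotient of two others. -/
theorem of_mul_eq {P Q R : PowerSeries ℂ} {u b c : ℂ}
    (hP : Summable fun j => ‖PowerSeries.coeff j P * u ^ j‖) (h : P * Q = R)
    (hQ : EvalsTo Q u b) (hR : EvalsTo R u c) (hb : b ≠ 0) : EvalsTo P u (c / b) := by
  have h1 : EvalsTo P u (∑' j, PowerSeries.coeff j P * u ^ j) := ⟨hP, hP.of_norm.hasSum⟩
  have h2 := h1.mul hQ
  rw [h] at h2
  rwa [← h2.unique hR, mul_div_cancel_right₀ _ hb]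

end EvalsTo

theorem integral_exp_int_mul_I (k : ℤ) :
    ∫ θ in (-π)..π, Complex.exp (k * Complex.I * θ) = if k = 0 then (2 * π : ℂ) else 0 := by
  split_ifs with h
  · subst h
    simp
    ring
  · have hk : (k : ℂ) * Complex.I ≠ 0 :=
      mul_ne_zero (Int.cast_ne_zero.2 h) Complex.I_ne_zero
    rw [integral_exp_mul_complex hk, div_eq_zero_iff]
    left
    rw [sub_eq_zero, Complex.exp_eq_exp_iff_exists_int]
    refine ⟨k, ?_⟩
    push_cast
    ring

/-- Cauchy's formula for the coefficients on a circle of absolute convergence. -/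
theorem integral_eq_coeff {P : PowerSeries ℂ} {r : ℝ} {K : ℝ → ℂ} (hr : 0 ≤ r)
    (h : ∀ θ : ℝ, EvalsTo P (r * Complex.exp (θ * Complex.I)) (K θ)) (m : ℕ) :
    ∫ θ in (-π)..π, K θ * Complex.exp (-(m * θ * Complex.I)) =
      2 * π * (PowerSeries.coeff m P * r ^ m) := by
  let F : ℕ → ℝ → ℂ := fun j θ =>
    PowerSeries.coeff j P * (r * Complex.exp (θ * Complex.I)) ^ j *
      Complex.exp (-(m * θ * Complex.I))
  have hF : ∀ j θ, F j θ = PowerSeries.coeff j P * r ^ j *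
      Complex.exp (((j - m : ℤ) : ℂ) * Complex.I * θ) := by
    intro j θ
    simp only [F]
    rw [mul_pow, ← Complex.exp_nat_mul, ← mul_assoc, mul_assoc _ (Complex.exp _) (Complex.exp _),
      ← Complex.exp_add]
    congr 2
    push_cast
    ring
  have hnorm : ∀ j θ, ‖F j θ‖ = ‖PowerSeries.coeff j P‖ * r ^ j := by
    intro j θ
    rw [hF, norm_mul, norm_mul, norm_pow, Complex.norm_real, Real.norm_of_nonneg hr,
      show ((j - m : ℤ) : ℂ) * Complex.I * θ = (((j - m : ℤ) : ℝ) * θ : ℝ) * Complex.I by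
        push_cast; ring, Complex.norm_exp_ofReal_mul_I, mul_one]
  have hs : Summable fun j => ‖PowerSeries.coeff j P‖ * r ^ j := by
    have := (h 0).1
    simpa [abs_of_nonneg hr] using this
  -- The terms have modulus independent of `θ`, so absolute convergence at one point of the circle
  -- dominates the whole series.
  have h1 := intervalIntegral.hasSum_integral_of_dominated_convergence (μ := MeasureTheory.volume)
    (a := -π) (b := π) (F := F) (f := fun θ => K θ * Complex.exp (-(m * θ * Complex.I)))
    (fun j _ => ‖PowerSeries.coeff j P‖ * r ^ j)
    (fun j => by
      apply Continuous.aestronglyMeasurable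
      simp only [F]
      fun_prop)
    (fun j => Filter.Eventually.of_forall fun θ _ => (hnorm j θ).le)
    (Filter.Eventually.of_forall fun θ _ => hs)
    (by simp)
    (Filter.Eventually.of_forall fun θ _ => (h θ).2.mul_right _)
  refine h1.unique ?_
  have h2 : ∀ j, ∫ θ in (-π)..π, F j θ =
      if j = m then 2 * π * (PowerSeries.coeff m P * r ^ m) else 0 := by
    intro j
    simp only [hF]
    rw [intervalIntegral.integral_const_mul, integral_exp_int_mul_I]
    by_cases hj : j = m
    · subst hj
      simp
      ring
    · rw [if_neg hj, if_neg (by omega)]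
      simp
  simp only [h2]
  exact hasSum_ite_eq m _

/-- Laplace's method on `[-π, π]` for large powers of a function with a unique maximum of its
modulus at `0`. -/
theorem tendsto_sqrt_mul_integral_pow {k ψ : ℝ → ℂ} {c s : ℝ} (hk : Continuous k)
    (hψ : Continuous ψ) (hc : 0 < c) (h0 : ψ 0 = 1)
    (hbound : ∀ θ, |θ| ≤ π → ‖ψ θ‖ ≤ Real.exp (-c * θ ^ 2))
    (hlim : Filter.Tendsto (fun θ : ℝ => (ψ θ - 1) / (θ : ℂ) ^ 2) (nhdsWithin 0 {0}ᶜ)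
      (nhds (-s : ℂ))) :
    Filter.Tendsto (fun N : ℕ => (√N : ℂ) * ∫ θ in (-π)..π, k θ * ψ θ ^ N) Filter.atTop
      (nhds (k 0 * ∫ x : ℝ, Complex.exp (-s * x ^ 2))) := by
  obtain ⟨M, hM⟩ := (isCompact_Icc (a := -π) (b := π)).exists_bound_of_continuousOn hk.continuousOn
  have hM0 : 0 ≤ M := (norm_nonneg _).trans (hM 0 ⟨by linarith [Real.pi_pos], Real.pi_pos.le⟩)
  -- The substitution `θ = x / √N` spreads the peak to unit scale; the indicator extends the
  -- integrand to all of `ℝ`. At `N = 0` the window is empty.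
  let G : ℕ → ℝ → ℂ := fun N => (Set.Ioc (-π * √N) (π * √N)).indicator
    fun x => k (x / √N) * ψ (x / √N) ^ N
  have hsq : Filter.Tendsto (fun N : ℕ => √(N : ℝ)) Filter.atTop Filter.atTop :=
    Real.tendsto_sqrt_atTop.comp tendsto_natCast_atTop_atTop
  have hG : ∀ N : ℕ, 0 < N →
      (√N : ℂ) * ∫ θ in (-π)..π, k θ * ψ θ ^ N = ∫ x, G N x := by
    intro N hN
    have hN' : 0 < √(N : ℝ) := Real.sqrt_pos.2 (Nat.cast_pos.2 hN)
    simp only [G]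
    rw [MeasureTheory.integral_indicator measurableSet_Ioc,
      ← intervalIntegral.integral_of_le (by nlinarith [Real.pi_pos]),
      intervalIntegral.integral_comp_div (fun x => k x * ψ x ^ N) hN'.ne',
      mul_div_cancel_right₀ _ hN'.ne', mul_div_cancel_right₀ _ hN'.ne', Complex.real_smul]
  have hmain : Filter.Tendsto (fun N => ∫ x, G N x) Filter.atTop
      (nhds (∫ x : ℝ, k 0 * Complex.exp (-s * x ^ 2))) := by
    refine MeasureTheory.tendsto_integral_of_dominated_convergence
      (fun x => M * Real.exp (-c * x ^ 2)) ?_ ((integrable_exp_neg_mul_sq hc).const_mul M) ?_ ?_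
    · intro N
      apply MeasureTheory.AEStronglyMeasurable.indicator _ measurableSet_Ioc
      apply Continuous.aestronglyMeasurable
      fun_prop
    · intro N
      refine Filter.Eventually.of_forall fun x => ?_
      simp only [G]
      by_cases hx : x ∈ Set.Ioc (-π * √N) (π * √N)
      · rw [Set.indicator_of_mem hx]
        have hN' : 0 < √(N : ℝ) := by
          by_contra hcon
          have : √(N : ℝ) = 0 := le_antisymm (not_lt.1 hcon) (Real.sqrt_nonneg _)
          rw [this] at hx
          simp only [mul_zero, Set.mem_Ioc] at hx
          linarith [hx.1, hx.2]
        have habs : |x / √N| ≤ π := by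
          rw [abs_div, abs_of_pos hN', div_le_iff₀ hN', abs_le]
          exact ⟨by linarith [hx.1], hx.2⟩
        rw [norm_mul, norm_pow]
        refine mul_le_mul (hM _ (abs_le.1 habs)) ?_ (by positivity) hM0
        calc ‖ψ (x / √N)‖ ^ N ≤ Real.exp (-c * (x / √N) ^ 2) ^ N :=
              pow_le_pow_left₀ (norm_nonneg _) (hbound _ habs) N
          _ = Real.exp (-c * x ^ 2) := by
              rw [← Real.exp_nat_mul]
              congr 1
              rw [div_pow, Real.sq_sqrt (Nat.cast_nonneg N)]
              have : (N : ℝ) ≠ 0 := fun h => by simp [h] at hN'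
              field_simp
      · rw [Set.indicator_of_notMem hx, norm_zero]
        positivity
    · refine Filter.Eventually.of_forall fun x => ?_
      have hz : Filter.Tendsto (fun N : ℕ => x / √(N : ℝ)) Filter.atTop (nhds 0) :=
        hsq.const_div_atTop x
      have hpow : Filter.Tendsto (fun N : ℕ => ψ (x / √N) ^ N) Filter.atTop
          (nhds (Complex.exp (-s * x ^ 2))) := by
        -- This is the exponent in `(1 + t / N) ^ N → exp t`. The point `x = 0` is separate because
        -- `hlim` is a punctured limit.
        have h1 : Filter.Tendsto (fun N : ℕ => (N : ℂ) * (ψ (x / √N) - 1)) Filter.atTop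
            (nhds (-s * x ^ 2)) := by
          rcases eq_or_ne x 0 with rfl | hx
          · simp [h0]
          · have hz' : Filter.Tendsto (fun N : ℕ => x / √(N : ℝ)) Filter.atTop
                (nhdsWithin 0 {0}ᶜ) := by
              refine tendsto_nhdsWithin_iff.2 ⟨hz, ?_⟩
              filter_upwards [Filter.eventually_gt_atTop 0] with N hN
              exact div_ne_zero hx (Real.sqrt_pos.2 (Nat.cast_pos.2 hN)).ne'
            refine ((hlim.comp hz').mul_const ((x : ℂ) ^ 2)).congr' ?_
            filter_upwards [Filter.eventually_gt_atTop 0] with N hN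
            have e : ((x / √N : ℝ) : ℂ) ^ 2 = x ^ 2 / N := by
              rw [← Complex.ofReal_pow, div_pow, Real.sq_sqrt (Nat.cast_nonneg N)]
              push_cast
              rfl
            have hxc : (x : ℂ) ≠ 0 := Complex.ofReal_ne_zero.2 hx
            have hNc : (N : ℂ) ≠ 0 := Nat.cast_ne_zero.2 hN.ne'
            simp only [Function.comp_apply, e]
            field_simp
        have := Complex.tendsto_one_add_pow_exp_of_tendsto h1
        simpa using this
      refine Filter.Tendsto.congr' ?_ (((hk.tendsto 0).comp hz).mul hpow)
      filter_upwards [hsq.eventually_gt_atTop (|x| / π)] with N hN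
      rw [div_lt_iff₀ Real.pi_pos] at hN
      have := abs_lt.1 hN
      simp only [G]
      have hx : x ∈ Set.Ioc (-π * √N) (π * √N) :=
        ⟨by linarith [this.1], by linarith [this.2]⟩
      rw [Set.indicator_of_mem hx]
      rfl
  rw [MeasureTheory.integral_const_mul] at hmain
  refine hmain.congr' ?_
  filter_upwards [Filter.eventually_gt_atTop 0] with N hN
  exact (hG N hN).symm

/-! ### The saddle point of `φ(u) / u` -/

namespace DistTree

/-- The function `φ(u) = 1 + u / (1 - u) ^ 2` that `weightSeries` sums to. -/
noncomputable def weightFun (u : ℂ) : ℂ := 1 + u / (1 - u) ^ 2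

/-- The equation of the positive critical point of `φ(u) / u`. -/
def IsCritical (τ : ℝ) : Prop := 0 < τ ∧ τ < 1 ∧ -1 + 3 * τ - τ ^ 2 + τ ^ 3 = 0

theorem one_sub_ne_zero {u : ℂ} (hu : ‖u‖ < 1) : 1 - u ≠ 0 := by
  intro h
  rw [← sub_eq_zero.1 h] at hu
  simp at hu

theorem summable_weightSeries {u : ℂ} (hu : ‖u‖ < 1) (r : ℕ) {f : ℕ → ℂ}
    (hf : ∀ j, ‖f j‖ ≤ ((j : ℝ) + 1) ^ r) : Summable fun j => ‖f j * u ^ j‖ := by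
  have h1 : Summable fun j : ℕ => ((j : ℝ) + 1) ^ r * ‖u‖ ^ j := by
    have h2 : ∀ j : ℕ, ((j : ℝ) + 1) ^ r * ‖u‖ ^ j =
        ∑ i ∈ Finset.range (r + 1), (r.choose i : ℝ) * ((j : ℝ) ^ i * ‖u‖ ^ j) := by
      intro j
      rw [add_pow, Finset.sum_mul]
      refine Finset.sum_congr rfl fun i _ => ?_
      ring
    simp only [h2]
    refine summable_sum fun i _ => Summable.mul_left _ ?_
    exact summable_pow_mul_geometric_of_norm_lt_one i (by simpa using hu)
  refine h1.of_nonneg_of_le (fun _ => norm_nonneg _) fun j => ?_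
  rw [norm_mul, norm_pow]
  exact mul_le_mul_of_nonneg_right (hf j) (by positivity)

theorem evalsTo_weightSeries {u : ℂ} (hu : ‖u‖ < 1) :
    EvalsTo (PowerSeries.map (Int.castRingHom ℂ) weightSeries) u (weightFun u) := by
  have h0 := one_sub_ne_zero hu
  have hs := summable_weightSeries hu 1
    (f := fun j => PowerSeries.coeff j (PowerSeries.map (Int.castRingHom ℂ) weightSeries)) (by
      intro j
      simp only [weightSeries, PowerSeries.coeff_map, PowerSeries.coeff_mk, weight, pow_one]
      split_ifs with h
      · simp
      · simp)
  have h2 := EvalsTo.coe ((1 - Polynomial.X) ^ 2) u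
  have h3 := EvalsTo.coe ((1 - Polynomial.X) ^ 2 + Polynomial.X) u
  have h4 := congrArg (PowerSeries.map (Int.castRingHom ℂ)) weightSeries_mul
  simp only [map_mul, map_add, map_pow, map_sub, map_one, PowerSeries.map_X] at h4
  simp only [Polynomial.coe_pow, Polynomial.coe_sub, Polynomial.coe_add, Polynomial.coe_one,
    Polynomial.coe_X, Polynomial.eval_pow, Polynomial.eval_sub, Polynomial.eval_add,
    Polynomial.eval_one, Polynomial.eval_X] at h2 h3
  convert EvalsTo.of_mul_eq hs h4 h2 h3 (pow_ne_zero 2 h0) using 1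
  rw [weightFun]
  field_simp

theorem coeff_derivative_degreeSeries (j : ℕ) :
    PowerSeries.coeff j (PowerSeries.derivative ℤ degreeSeries) = ((j : ℤ) + 1) ^ 3 := by
  rw [PowerSeries.coeff_derivative, degreeSeries, PowerSeries.coeff_succ_X_mul,
    PowerSeries.coeff_derivative, weightSeries, PowerSeries.coeff_mk, weight,
    if_neg (Nat.succ_ne_zero j)]
  push_cast
  ring

theorem evalsTo_derivative_degreeSeries {u : ℂ} (hu : ‖u‖ < 1) :
    EvalsTo (PowerSeries.map (Int.castRingHom ℂ) (PowerSeries.derivative ℤ degreeSeries)) u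
      ((1 + 4 * u + u ^ 2) / (1 - u) ^ 4) := by
  have h0 := one_sub_ne_zero hu
  have hs := summable_weightSeries hu 3
    (f := fun j => PowerSeries.coeff j
      (PowerSeries.map (Int.castRingHom ℂ) (PowerSeries.derivative ℤ degreeSeries))) (by
      intro j
      simp only [PowerSeries.coeff_map, coeff_derivative_degreeSeries]
      apply le_of_eq
      have : (Int.castRingHom ℂ) (((j : ℤ) + 1) ^ 3) = ((((j : ℝ) + 1) ^ 3 : ℝ) : ℂ) := by
        simp
      rw [this, Complex.norm_real, Real.norm_of_nonneg (by positivity)])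
  have h2 := EvalsTo.coe ((1 - Polynomial.X) ^ 4) u
  have h3 := EvalsTo.coe (1 + Polynomial.C 4 * Polynomial.X + Polynomial.X ^ 2) u
  have h4 := congrArg (PowerSeries.map (Int.castRingHom ℂ)) derivative_degreeSeries_mul
  simp only [map_mul, map_add, map_pow, map_sub, map_one, PowerSeries.map_X, map_ofNat] at h4
  simp only [Polynomial.coe_pow, Polynomial.coe_sub, Polynomial.coe_add, Polynomial.coe_one,
    Polynomial.coe_X, Polynomial.coe_mul, Polynomial.coe_C, Polynomial.eval_pow,
    Polynomial.eval_sub, Polynomial.eval_add, Polynomial.eval_one, Polynomial.eval_X,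
    Polynomial.eval_mul, Polynomial.eval_C, map_ofNat PowerSeries.C] at h2 h3
  exact EvalsTo.of_mul_eq hs h4 h2 h3 (pow_ne_zero 4 h0)

theorem weightFun_ofReal (τ : ℝ) : weightFun τ = ((1 + τ / (1 - τ) ^ 2 : ℝ) : ℂ) := by
  simp [weightFun]

/-- All coefficients of `φ` are positive, so the terms of degree at least two are bounded by their
value at `τ`, and the gain comes from `1 + u` alone: `|1 + u| ^ 2 = 1 + τ ^ 2 + 2 τ cos θ` with `cos
θ ≤ 1 - 2 θ ^ 2 / π ^ 2`. The constant is chosen so that completing the square leaves only the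
surplus `d ^ 2`. -/
theorem norm_weightFun_le {τ : ℝ} (h0 : 0 < τ) (h1 : τ < 1) {θ : ℝ} (hθ : |θ| ≤ π) :
    ‖weightFun (τ * Complex.exp (θ * Complex.I))‖ ≤
      1 + τ / (1 - τ) ^ 2 - 2 * τ / (π ^ 2 * (1 + τ)) * θ ^ 2 := by
  set u : ℂ := τ * Complex.exp (θ * Complex.I) with hu
  have hun : ‖u‖ = τ := by
    rw [hu, norm_mul, Complex.norm_exp_ofReal_mul_I, mul_one, Complex.norm_real,
      Real.norm_of_nonneg h0.le]
  have hne := one_sub_ne_zero (hun.trans_lt h1)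
  have hτ : 0 < 1 - τ := by linarith
  have hsplit : weightFun u = (1 + u) + u ^ 2 * ((1 - u)⁻¹ + ((1 - u) ^ 2)⁻¹) := by
    rw [weightFun]
    field_simp
    ring
  have hlow : 1 - τ ≤ ‖1 - u‖ := by
    have := norm_sub_norm_le (1 : ℂ) u
    rwa [norm_one, hun] at this
  have htail : ‖u ^ 2 * ((1 - u)⁻¹ + ((1 - u) ^ 2)⁻¹)‖ ≤
      τ ^ 2 * ((1 - τ)⁻¹ + ((1 - τ) ^ 2)⁻¹) := by
    rw [norm_mul, norm_pow, hun]
    refine mul_le_mul_of_nonneg_left ((norm_add_le _ _).trans ?_) (by positivity)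
    rw [norm_inv, norm_inv, norm_pow]
    gcongr
  have hsq : ‖1 + u‖ ^ 2 = 1 + τ ^ 2 + 2 * τ * Real.cos θ := by
    rw [← Complex.normSq_eq_norm_sq, Complex.normSq_apply, hu, Complex.exp_mul_I]
    simp [← Complex.ofReal_cos, ← Complex.ofReal_sin]
    linear_combination τ ^ 2 * Real.sin_sq_add_cos_sq θ
  have hcos := Real.cos_le_one_sub_mul_cos_sq hθ
  have hhead : ‖1 + u‖ ≤ 1 + τ - 2 * τ / (π ^ 2 * (1 + τ)) * θ ^ 2 := by
    have hπ := Real.pi_pos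
    have hθ2 : θ ^ 2 ≤ π ^ 2 := sq_le_sq' (abs_le.1 hθ).1 (abs_le.1 hθ).2
    have hd : 2 * τ / (π ^ 2 * (1 + τ)) * θ ^ 2 * (1 + τ) = 2 * τ * (θ ^ 2 / π ^ 2) := by
      field_simp
    have hq : θ ^ 2 / π ^ 2 ≤ 1 := (div_le_one (by positivity)).2 hθ2
    have hq' : 2 / π ^ 2 * θ ^ 2 = 2 * (θ ^ 2 / π ^ 2) := by ring
    rw [hq'] at hcos
    set d := 2 * τ / (π ^ 2 * (1 + τ)) * θ ^ 2 with hd'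
    set q := θ ^ 2 / π ^ 2
    have hd1 : d ≤ 1 + τ := by
      by_contra hcon
      push Not at hcon
      nlinarith
    refine le_of_sq_le_sq ?_ (by linarith)
    rw [hsq]
    nlinarith [sq_nonneg d]
  have hreal : (1 + τ) + τ ^ 2 * ((1 - τ)⁻¹ + ((1 - τ) ^ 2)⁻¹) = 1 + τ / (1 - τ) ^ 2 := by
    field_simp
    ring
  rw [hsplit]
  refine (norm_add_le _ _).trans ?_
  linarith

/-- Asymptotics of the coefficients of `H φ ^ (n + 1)`, from the saddle point at `τ`. -/
theorem exists_tendsto_coeff_mul_pow {τ : ℝ} (hτ : IsCritical τ) :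
    ∃ κ : ℂ, κ ≠ 0 ∧ ∀ (H : PowerSeries ℂ) (h : ℂ → ℂ),
      (∀ u : ℂ, ‖u‖ < 1 → EvalsTo H u (h u)) → ContinuousOn h (Metric.ball 0 1) →
      Filter.Tendsto (fun n : ℕ => (√(n + 1 : ℕ) : ℂ) * (τ ^ n / weightFun τ ^ (n + 1)) *
        PowerSeries.coeff n
          (H * PowerSeries.map (Int.castRingHom ℂ) weightSeries ^ (n + 1))) Filter.atTop
        (nhds (h τ * κ)) := by
  obtain ⟨h0, h1, hcrit⟩ := hτ
  have hb : 0 < 1 - τ := by linarith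
  set φ : ℝ := 1 + τ / (1 - τ) ^ 2 with hφ
  have hφ0 : 0 < φ := by positivity
  -- This is `τ ^ 3 / φ * g τ` for the `g` introduced below, the negative of the quadratic Taylor
  -- coefficient of `ψ` at `0`.
  set s : ℝ := τ ^ 3 / φ * (1 / τ ^ 3 + 3 / (1 - τ) ^ 4) with hs
  have hs0 : 0 < s := by positivity
  let U : ℝ → ℂ := fun θ => τ * Complex.exp (θ * Complex.I)
  have hUn : ∀ θ, ‖U θ‖ = τ := by
    intro θ
    rw [norm_mul, Complex.norm_exp_ofReal_mul_I, mul_one, Complex.norm_real,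
      Real.norm_of_nonneg h0.le]
  have hU1 : ∀ θ, ‖U θ‖ < 1 := fun θ => (hUn θ).trans_lt h1
  have hUc : Continuous U := by fun_prop
  have hU0 : U 0 = τ := by simp [U]
  have hUne : ∀ θ, U θ ≠ 0 := fun θ => by
    rw [← norm_ne_zero_iff, hUn]
    exact h0.ne'
  have hτc : (τ : ℂ) ≠ 0 := Complex.ofReal_ne_zero.2 h0.ne'
  have hφc : (φ : ℂ) ≠ 0 := Complex.ofReal_ne_zero.2 hφ0.ne'
  have hbc : (1 - τ : ℂ) ≠ 0 := by exact_mod_cast hb.ne'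
  have hcritc : (-1 + 3 * τ - τ ^ 2 + τ ^ 3 : ℂ) = 0 := by exact_mod_cast hcrit
  have hφτ : weightFun τ = φ := weightFun_ofReal τ
  -- This is `φ(u) / u` on the circle, divided by its value at `τ`.
  let ψ : ℝ → ℂ := fun θ => weightFun (U θ) * Complex.exp (-(θ * Complex.I)) / φ
  have hψc : Continuous ψ := by
    have : ∀ θ, (1 - U θ) ^ 2 ≠ 0 := fun θ => pow_ne_zero _ (one_sub_ne_zero (hU1 θ))
    simp only [ψ, weightFun]
    fun_prop (disch := assumption)
  have hψ0 : ψ 0 = 1 := by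
    simp only [ψ, hU0, hφτ]
    simp [hφc]
  have hbound : ∀ θ, |θ| ≤ π →
      ‖ψ θ‖ ≤ Real.exp (-(2 * τ / (π ^ 2 * (1 + τ)) / φ) * θ ^ 2) := by
    intro θ hθ
    have hn : ‖ψ θ‖ = ‖weightFun (U θ)‖ / φ := by
      simp only [ψ]
      rw [norm_div, norm_mul, Complex.norm_real, Real.norm_of_nonneg hφ0.le,
        show -((θ : ℂ) * Complex.I) = ((-θ : ℝ) : ℂ) * Complex.I by push_cast; ring,
        Complex.norm_exp_ofReal_mul_I, mul_one]
    rw [hn]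
    calc ‖weightFun (U θ)‖ / φ ≤ (φ - 2 * τ / (π ^ 2 * (1 + τ)) * θ ^ 2) / φ :=
          div_le_div_of_nonneg_right (norm_weightFun_le h0 h1 hθ) hφ0.le
      _ = -(2 * τ / (π ^ 2 * (1 + τ)) / φ) * θ ^ 2 + 1 := by
          field_simp
          ring
      _ ≤ _ := Real.add_one_le_exp _
  have hlim : Filter.Tendsto (fun θ : ℝ => (ψ θ - 1) / (θ : ℂ) ^ 2) (nhdsWithin 0 {0}ᶜ)
      (nhds (-s : ℂ)) := by
    -- Criticality makes `φ(u) / u - φ(τ) / τ` vanish doubly at `τ`; `g` is the exact cofactor of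
    -- `(u - τ) ^ 2`.
    let g : ℂ → ℂ := fun u =>
      1 / (u * τ ^ 2) + ((1 - τ) + 2 * (1 - u)) / ((1 - u) ^ 2 * (1 - τ) ^ 3)
    have hψg : ∀ θ, ψ θ - 1 = τ / φ * ((U θ - τ) ^ 2 * g (U θ)) := by
      intro θ
      have he : Complex.exp (-(θ * Complex.I)) = τ / U θ := by
        simp only [U]
        rw [Complex.exp_neg]
        field_simp
      have hne := one_sub_ne_zero (hU1 θ)
      have hne' := hUne θ
      have hφe : (φ : ℂ) = 1 + τ / (1 - τ) ^ 2 := by simp [hφ]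
      have key : weightFun (U θ) / U θ - φ / τ = (U θ - τ) ^ 2 * g (U θ) := by
        rw [hφe]
        simp only [weightFun, g]
        generalize U θ = u at hne hne'
        field_simp
        linear_combination (u * (1 - u) ^ 2 * (u - τ)) * hcritc
      simp only [ψ]
      rw [he, ← key]
      field_simp
    have hd : Filter.Tendsto (fun θ : ℝ => (U θ - τ) / (θ : ℂ)) (nhdsWithin 0 {0}ᶜ)
        (nhds (τ * Complex.I)) := by
      have : HasDerivAt U (τ * Complex.I) 0 := by
        have h2 : HasDerivAt (fun θ : ℝ => (θ : ℂ) * Complex.I) Complex.I 0 := by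
          simpa using (Complex.ofRealCLM.hasDerivAt (x := (0 : ℝ))).mul_const Complex.I
        simpa using (h2.cexp).const_mul (τ : ℂ)
      have h3 := hasDerivAt_iff_tendsto_slope.1 this
      refine h3.congr fun θ => ?_
      rw [slope_def_module, hU0, sub_zero, Complex.real_smul, Complex.ofReal_inv]
      ring
    have hg : Filter.Tendsto (fun θ : ℝ => g (U θ)) (nhdsWithin 0 {0}ᶜ) (nhds (g τ)) := by
      have hgc : ContinuousAt g τ := by
        have e1 : (τ : ℂ) * τ ^ 2 ≠ 0 := by positivity
        have e2 : (1 - τ : ℂ) ^ 2 * (1 - τ) ^ 3 ≠ 0 := mul_ne_zero (pow_ne_zero _ hbc) (pow_ne_zero _ hbc)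
        simp only [g]
        fun_prop (disch := assumption)
      have := hUc.tendsto 0
      rw [hU0] at this
      exact (hgc.tendsto.comp this).mono_left nhdsWithin_le_nhds
    have hfin := ((hd.pow 2).mul hg).const_mul ((τ : ℂ) / φ)
    have hval : (τ : ℂ) / φ * ((τ * Complex.I) ^ 2 * g τ) = -s := by
      simp only [g, hs]
      push_cast
      rw [mul_pow, Complex.I_sq]
      field_simp
      ring
    rw [hval] at hfin
    refine hfin.congr fun θ => ?_
    rw [hψg]
    ring
  refine ⟨(2 * π : ℂ)⁻¹ * ∫ x : ℝ, Complex.exp (-s * x ^ 2), ?_, ?_⟩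
  · have h2π : (2 * π : ℂ) ≠ 0 := by exact_mod_cast Real.two_pi_pos.ne'
    refine mul_ne_zero (inv_ne_zero h2π) ?_
    rw [integral_gaussian_complex (by simpa using hs0)]
    intro h
    exact (div_ne_zero Real.pi_pos.ne' hs0.ne') (by exact_mod_cast ((Complex.cpow_eq_zero_iff _ _).1 h).1)
  · intro H h hev hcont
    -- The factor `exp (θ I)` compensates for extracting coefficient `n` from a power `n + 1`.
    let k : ℝ → ℂ := fun θ => h (U θ) * Complex.exp (θ * Complex.I)
    have hkc : Continuous k := by
      have : Continuous fun θ => h (U θ) :=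
        hcont.comp_continuous hUc fun θ => by simpa using hU1 θ
      exact this.mul (by fun_prop)
    have hL := tendsto_sqrt_mul_integral_pow hkc hψc (c := 2 * τ / (π ^ 2 * (1 + τ)) / φ)
      (by positivity) hψ0 hbound hlim
    have hint : ∀ n : ℕ, ∫ θ in (-π)..π, k θ * ψ θ ^ (n + 1) =
        2 * π * (τ ^ n / weightFun τ ^ (n + 1) * PowerSeries.coeff n
          (H * PowerSeries.map (Int.castRingHom ℂ) weightSeries ^ (n + 1))) := by
      intro n
      have h2 := integral_eq_coeff (K := fun θ => h (U θ) * weightFun (U θ) ^ (n + 1)) h0.le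
        (fun θ => (hev _ (hU1 θ)).mul ((evalsTo_weightSeries (hU1 θ)).pow (n + 1))) n
      have h3 : ∀ θ : ℝ, k θ * ψ θ ^ (n + 1) = (φ ^ (n + 1) : ℂ)⁻¹ *
          (h (U θ) * weightFun (U θ) ^ (n + 1) * Complex.exp (-(n * θ * Complex.I))) := by
        intro θ
        have h4 : Complex.exp (-(n * θ * Complex.I)) =
            Complex.exp (θ * Complex.I) * Complex.exp (-(θ * Complex.I)) ^ (n + 1) := by
          rw [← Complex.exp_nat_mul, ← Complex.exp_add]
          congr 1
          push_cast
          ring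
        simp only [k, ψ]
        rw [h4, div_pow, mul_pow]
        ring
      simp only [h3]
      rw [intervalIntegral.integral_const_mul, h2, hφτ]
      ring
    have hk0 : k 0 = h τ := by simp [k, hU0]
    have h5 := ((Filter.tendsto_add_atTop_iff_nat 1).2 hL).const_mul ((2 * π : ℂ)⁻¹)
    rw [hk0] at h5
    have h2π : (2 * π : ℂ) ≠ 0 := by exact_mod_cast Real.two_pi_pos.ne'
    rw [mul_left_comm]
    refine h5.congr fun n => ?_
    rw [hint]
    field_simp

end DistTree

/-! ### Limit of the expected root degree -/

namespace DistTree

theorem map_genFun_eq : PowerSeries.map (Int.castRingHom ℂ) genFun = PowerSeries.X *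
    (PowerSeries.map (Int.castRingHom ℂ) weightSeries).subst
      (PowerSeries.map (Int.castRingHom ℂ) genFun) := by
  have h0 : PowerSeries.HasSubst genFun :=
    PowerSeries.HasSubst.of_constantCoeff_zero' constantCoeff_genFun
  have h := congrArg (PowerSeries.map (Int.castRingHom ℂ)) genFun_eq
  rw [map_mul, PowerSeries.map_X] at h
  exact h.trans (congrArg (PowerSeries.X * ·) (PowerSeries.map_subst h0 weightSeries))

theorem map_rootGenFunDeriv_eq : PowerSeries.map (Int.castRingHom ℂ) rootGenFunDeriv =
    PowerSeries.X * (PowerSeries.map (Int.castRingHom ℂ) degreeSeries).subst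
      (PowerSeries.map (Int.castRingHom ℂ) genFun) := by
  have h0 : PowerSeries.HasSubst genFun :=
    PowerSeries.HasSubst.of_constantCoeff_zero' constantCoeff_genFun
  have h := congrArg (PowerSeries.map (Int.castRingHom ℂ)) rootGenFunDeriv_eq
  rw [map_mul, PowerSeries.map_X] at h
  exact h.trans (congrArg (PowerSeries.X * ·) (PowerSeries.map_subst h0 degreeSeries))

theorem lagrange (H : PowerSeries ℂ) (n : ℕ) :
    (n + 1 : ℂ) * PowerSeries.coeff (n + 1)
        (H.subst (PowerSeries.map (Int.castRingHom ℂ) genFun) : PowerSeries ℂ) =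
      PowerSeries.coeff n (PowerSeries.derivative ℂ H *
        PowerSeries.map (Int.castRingHom ℂ) weightSeries ^ (n + 1)) := by
  refine PowerSeries.coeff_subst_of_eq_X_mul_subst ?_ (constantCoeff_map_genFun _)
    map_genFun_eq H n
  rw [← PowerSeries.coeff_zero_eq_constantCoeff_apply]
  simp [weightSeries, weight]

theorem coeff_genFun_eq (n : ℕ) :
    ((PowerSeries.coeff (n + 1) genFun : ℤ) : ℂ) = PowerSeries.coeff n
      (1 * PowerSeries.map (Int.castRingHom ℂ) weightSeries ^ (n + 1)) / (n + 1) := by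
  have h := lagrange PowerSeries.X n
  rw [PowerSeries.subst_X (PowerSeries.HasSubst.of_constantCoeff_zero'
    (constantCoeff_map_genFun _)), PowerSeries.derivative_X] at h
  rw [← h, mul_div_cancel_left₀ _ (Nat.cast_add_one_ne_zero n), PowerSeries.coeff_map]
  rfl

/-- Because `D = X * G(A)`, size `n + 2` involves only the power `n + 1` of `φ`, one less than for
`A` at the same size. -/
theorem coeff_rootGenFunDeriv_eq (n : ℕ) :
    ((PowerSeries.coeff (n + 2) rootGenFunDeriv : ℤ) : ℂ) = PowerSeries.coeff n
      (PowerSeries.map (Int.castRingHom ℂ) (PowerSeries.derivative ℤ degreeSeries) *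
        PowerSeries.map (Int.castRingHom ℂ) weightSeries ^ (n + 1)) / (n + 1) := by
  have hd : PowerSeries.map (Int.castRingHom ℂ) (PowerSeries.derivative ℤ degreeSeries) =
      PowerSeries.derivative ℂ (PowerSeries.map (Int.castRingHom ℂ) degreeSeries) := by
    ext j
    simp [PowerSeries.coeff_derivative]
  have h : ((PowerSeries.coeff (n + 2) rootGenFunDeriv : ℤ) : ℂ) =
      PowerSeries.coeff (n + 2) (PowerSeries.map (Int.castRingHom ℂ) rootGenFunDeriv) := by
    rw [PowerSeries.coeff_map]
    rfl
  rw [h, map_rootGenFunDeriv_eq, PowerSeries.coeff_succ_X_mul, hd, ← lagrange,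
    mul_div_cancel_left₀ _ (Nat.cast_add_one_ne_zero n)]

theorem tendsto_add_one_div_natCast :
    Filter.Tendsto (fun n : ℕ => ((n + 2 : ℝ) / (n + 1))) Filter.atTop (nhds 1) := by
  have h := (tendsto_one_div_add_atTop_nhds_zero_nat (𝕜 := ℝ)).const_add 1
  rw [add_zero] at h
  refine h.congr fun n => ?_
  field_simp
  ring

/-- Undoes the saddle-point normalisations, with `t = τ`, `p = φ(τ)`, `r₁, r₂` the square roots and
`n₁, n₂` the Lagrange factors. For `y = 0` both sides are `0` by the division convention, so the
coefficients need not be shown nonzero. -/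
theorem div_eq_of_scaled {n₁ n₂ r₁ r₂ t p : ℂ} (n : ℕ) (h₁ : n₁ ≠ 0) (h₂ : n₂ ≠ 0) (hr₂ : r₂ ≠ 0)
    (hr₁ : r₁ ≠ 0) (ht : t ≠ 0) (hp : p ≠ 0) (x y : ℂ) :
    t / p * (n₂ / n₁ * (r₂ / r₁) * (r₁ * (t ^ n / p ^ (n + 1)) * x /
      (r₂ * (t ^ (n + 1) / p ^ (n + 1 + 1)) * y))) = x / n₁ / (y / n₂) := by
  rcases eq_or_ne y 0 with rfl | hy
  · simp
  · field_simp
    ring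

/-- The expected root degree converges to `ρ G'(τ)`, with `ρ = τ / φ(τ)` and `G(u) = u φ'(u)`. -/
theorem tendsto_avgRootDegree {τ : ℝ} (hτ : IsCritical τ) :
    Filter.Tendsto avgRootDegree Filter.atTop
      (nhds (τ / (1 + τ / (1 - τ) ^ 2) * (1 + 4 * τ + τ ^ 2) / (1 - τ) ^ 4)) := by
  obtain ⟨κ, hκ, hκlim⟩ := exists_tendsto_coeff_mul_pow hτ
  obtain ⟨h0, h1, -⟩ := hτ
  have hb : 0 < 1 - τ := by linarith
  have hφ0 : 0 < 1 + τ / (1 - τ) ^ 2 := by positivity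
  have hτc : (τ : ℂ) ≠ 0 := Complex.ofReal_ne_zero.2 h0.ne'
  have hφc : weightFun τ ≠ 0 := by
    rw [weightFun_ofReal]
    exact Complex.ofReal_ne_zero.2 hφ0.ne'
  have hD := hκlim (PowerSeries.map (Int.castRingHom ℂ) (PowerSeries.derivative ℤ degreeSeries))
    (fun u => (1 + 4 * u + u ^ 2) / (1 - u) ^ 4)
    (fun u hu => evalsTo_derivative_degreeSeries hu) (by
      have : ∀ u ∈ Metric.ball (0 : ℂ) 1, (1 - u) ^ 4 ≠ 0 := fun u hu =>
        pow_ne_zero _ (one_sub_ne_zero (by simpa using hu))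
      fun_prop (disch := assumption))
  have hA := (Filter.tendsto_add_atTop_iff_nat 1).2
    (hκlim 1 (fun _ => 1) (fun u _ => EvalsTo.one u) continuousOn_const)
  rw [one_mul] at hA
  have hratio := hD.div hA hκ
  rw [mul_div_cancel_right₀ _ hκ] at hratio
  have hn : Filter.Tendsto (fun n : ℕ => (((n + 2 : ℝ) / (n + 1) * √((n + 2 : ℝ) / (n + 1)) : ℝ) : ℂ))
      Filter.atTop (nhds 1) := by
    have := tendsto_add_one_div_natCast.mul (tendsto_add_one_div_natCast.sqrt)
    have h2 := (Complex.continuous_ofReal.tendsto _).comp this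
    rw [Real.sqrt_one, mul_one, Complex.ofReal_one] at h2
    exact h2
  have hlim := (hn.mul hratio).const_mul (τ / weightFun τ)
  rw [← Filter.tendsto_add_atTop_iff_nat 2]
  have hfin : Filter.Tendsto (fun n : ℕ => ((avgRootDegree (n + 2) : ℝ) : ℂ)) Filter.atTop
      (nhds ((τ / (1 + τ / (1 - τ) ^ 2) * (1 + 4 * τ + τ ^ 2) / (1 - τ) ^ 4 : ℝ) : ℂ)) := by
    have hval : ((τ / (1 + τ / (1 - τ) ^ 2) * (1 + 4 * τ + τ ^ 2) / (1 - τ) ^ 4 : ℝ) : ℂ) =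
        τ / weightFun τ * (1 * ((1 + 4 * τ + τ ^ 2) / (1 - τ) ^ 4)) := by
      rw [weightFun]
      push_cast
      ring
    rw [hval]
    refine hlim.congr fun n => ?_
    rw [avgRootDegree_eq, Complex.ofReal_div, Complex.ofReal_intCast, Complex.ofReal_intCast]
    rw [coeff_rootGenFunDeriv_eq, show n + 2 = n + 1 + 1 from rfl, coeff_genFun_eq]
    have e1 : √((n + 2 : ℝ) / (n + 1)) = √((n + 1 + 1 : ℕ) : ℝ) / √((n + 1 : ℕ) : ℝ) := by
      rw [← Real.sqrt_div' _ (Nat.cast_nonneg _)]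
      push_cast
      ring_nf
    have e2 : (√((n + 1 + 1 : ℕ) : ℝ) : ℂ) ≠ 0 :=
      Complex.ofReal_ne_zero.2 (Real.sqrt_pos.2 (by positivity)).ne'
    have e3 : (√((n + 1 : ℕ) : ℝ) : ℂ) ≠ 0 :=
      Complex.ofReal_ne_zero.2 (Real.sqrt_pos.2 (by positivity)).ne'
    have e4 : (n + 1 : ℂ) ≠ 0 := Nat.cast_add_one_ne_zero n
    have e5 : (n + 2 : ℂ) ≠ 0 := by exact_mod_cast (Nat.succ_ne_zero (n + 1))
    have e6 : (((n + 2 : ℝ) / (n + 1) : ℝ) : ℂ) = (n + 2) / (n + 1) := by push_cast; rfl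
    rw [Pi.div_apply, Complex.ofReal_mul, e6, e1, Complex.ofReal_div,
      show ((n + 1 : ℕ) : ℂ) + 1 = n + 2 by push_cast; ring]
    exact div_eq_of_scaled n e4 e5 e2 e3 hτc hφc _ _
  have := (Complex.continuous_re.tendsto _).comp hfin
  exact this

/-! ### Numerical bounds -/

theorem exists_isCritical : ∃ τ : ℝ, IsCritical τ ∧
    (361103080528647 : ℝ) / 10 ^ 15 < τ ∧ τ < (361103080528648 : ℝ) / 10 ^ 15 := by
  have h := intermediate_value_Ioo (f := fun x : ℝ => -1 + 3 * x - x ^ 2 + x ^ 3)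
    (a := (361103080528647 : ℝ) / 10 ^ 15) (b := (361103080528648 : ℝ) / 10 ^ 15)
    (by norm_num) (by fun_prop)
  obtain ⟨τ, hτ, hτ0⟩ := h (show (0 : ℝ) ∈ Set.Ioo _ _ by constructor <;> norm_num)
  refine ⟨τ, ⟨lt_trans (by norm_num) hτ.1, lt_trans hτ.2 (by norm_num), hτ0⟩, hτ.1, hτ.2⟩

theorem avgRootDegree_limit_bounds {τ : ℝ} (hτ1 : (361103080528647 : ℝ) / 10 ^ 15 < τ)
    (hτ2 : τ < (361103080528648 : ℝ) / 10 ^ 15) :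
    2.960894939 < τ / (1 + τ / (1 - τ) ^ 2) * (1 + 4 * τ + τ ^ 2) / (1 - τ) ^ 4 ∧
      τ / (1 + τ / (1 - τ) ^ 2) * (1 + 4 * τ + τ ^ 2) / (1 - τ) ^ 4 < 2.960894940 := by
  have h0 : 0 < τ := lt_trans (by norm_num) hτ1
  have hb : 0 < 1 - τ := by
    have : τ < 1 := lt_trans hτ2 (by norm_num)
    linarith
  have e : τ / (1 + τ / (1 - τ) ^ 2) * (1 + 4 * τ + τ ^ 2) / (1 - τ) ^ 4 =
      τ * (1 + 4 * τ + τ ^ 2) / (((1 - τ) ^ 2 + τ) * (1 - τ) ^ 2) := by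
    field_simp
  have hden : 0 < ((1 - τ) ^ 2 + τ) * (1 - τ) ^ 2 := by positivity
  rw [e, lt_div_iff₀ hden, div_lt_iff₀ hden]
  obtain ⟨a, ha⟩ : ∃ a : ℝ, a = 361103080528647 / 10 ^ 15 := ⟨_, rfl⟩
  obtain ⟨b, hb'⟩ : ∃ b : ℝ, b = 361103080528648 / 10 ^ 15 := ⟨_, rfl⟩
  rw [← ha] at hτ1
  rw [← hb'] at hτ2
  have ha0 : 0 < a := by rw [ha]; norm_num
  have hb1 : 0 < 1 - b := by rw [hb']; norm_num
  constructor
  -- `(1 - τ) ^ 2 + τ` mixes a decreasing and an increasing term, so each occurrence of `τ` is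
  -- replaced by its own unfavourable endpoint.
  · calc 2.960894939 * (((1 - τ) ^ 2 + τ) * (1 - τ) ^ 2)
        ≤ 2.960894939 * (((1 - a) ^ 2 + b) * (1 - a) ^ 2) := by gcongr
      _ < a * (1 + 4 * a + a ^ 2) := by rw [ha, hb']; norm_num
      _ ≤ _ := by gcongr
  · calc τ * (1 + 4 * τ + τ ^ 2) ≤ b * (1 + 4 * b + b ^ 2) := by gcongr
      _ < 2.960894940 * (((1 - b) ^ 2 + a) * (1 - b) ^ 2) := by rw [ha, hb']; norm_num
      _ ≤ _ := by gcongr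

end DistTree

/-! ### Ordered trees and Catalan numbers -/

namespace OrderedTree

theorem one_le_size (t : OrderedTree) : 1 ≤ t.size := by
  cases t
  simp [size]

theorem card_size_rootDegree (n j : ℕ) :
    Nat.card {t : {t : OrderedTree // t.size = n + 1} // t.1.rootDegree = j} =
      1 * Nat.card {c : Fin j → OrderedTree // ∑ i, (c i).size = n} := by
  let f : {c : Fin j → OrderedTree // ∑ i, (c i).size = n} →
      {t : {t : OrderedTree // t.size = n + 1} // t.1.rootDegree = j} := fun x =>
    ⟨⟨node j x.1, by rw [size, x.2, add_comm]⟩, rfl⟩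
  have hf : Function.Bijective f := by
    constructor
    · rintro ⟨c, hc⟩ ⟨c', hc'⟩ he
      have := congrArg (fun t => t.1.1) he
      simp only [f, node.injEq, heq_eq_eq, true_and] at this
      subst this
      rfl
    · rintro ⟨⟨⟨k, c⟩, h⟩, h0⟩
      simp only [rootDegree] at h0
      subst h0
      exact ⟨⟨c, by rw [size] at h; omega⟩, rfl⟩
  rw [one_mul, Nat.card_congr (Equiv.ofBijective f hf)]

/-- The generating function of ordered trees by the number of nodes. -/
noncomputable def genFun : PowerSeries ℤ :=
  PowerSeries.mk fun n => (Fintype.card {t : OrderedTree // t.size = n} : ℤ)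

theorem sum_rootDegree_eq (g : ℕ → ℤ) (n : ℕ) :
    ∑ t : {t : OrderedTree // t.size = n + 1}, g t.1.rootDegree =
      ∑ j ∈ Finset.range (n + 1), g j * PowerSeries.coeff n (genFun ^ j) := by
  have h := sum_degree_eq (R := ℤ) size rootDegree (fun _ => 1) n ?_ (card_size_rootDegree n) g
  · simpa [genFun] using h
  · rintro ⟨k, c⟩ h
    rw [size] at h
    have := le_sum_of_one_le size one_le_size c
    simp only [rootDegree]
    omega

theorem constantCoeff_genFun : PowerSeries.constantCoeff genFun = 0 := by
  have : IsEmpty {t : OrderedTree // t.size = 0} :=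
    ⟨fun t => by have := one_le_size t.1; have := t.2; omega⟩
  rw [← PowerSeries.coeff_zero_eq_constantCoeff_apply, genFun, PowerSeries.coeff_mk]
  simp

theorem genFun_eq_subst :
    genFun = PowerSeries.X * (PowerSeries.mk (1 : ℕ → ℤ)).subst genFun := by
  ext (_ | n)
  · simp [constantCoeff_genFun]
  · rw [PowerSeries.coeff_succ_X_mul, coeff_subst_eq_sum_range constantCoeff_genFun]
    have := sum_rootDegree_eq (fun _ => 1) n
    simp only [Finset.sum_const, Finset.card_univ, nsmul_eq_mul, mul_one] at this
    rw [genFun, PowerSeries.coeff_mk]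
    refine this.trans (Finset.sum_congr rfl fun j _ => ?_)
    rw [PowerSeries.coeff_mk, Pi.one_apply, one_smul, one_mul]
    rfl

theorem hasSubst_genFun : PowerSeries.HasSubst genFun :=
  PowerSeries.HasSubst.of_constantCoeff_zero' constantCoeff_genFun

theorem mk_one_subst_mul :
    ((PowerSeries.mk (1 : ℕ → ℤ)).subst genFun : PowerSeries ℤ) * (1 - genFun) = 1 := by
  have h := congrArg (PowerSeries.substAlgHom hasSubst_genFun)
    (PowerSeries.mk_one_mul_one_sub_eq_one ℤ)
  simp only [map_mul, map_sub, map_one, PowerSeries.substAlgHom_X] at h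
  rwa [PowerSeries.coe_substAlgHom] at h

theorem genFun_eq : genFun = PowerSeries.X + genFun ^ 2 := by
  have h := genFun_eq_subst
  linear_combination (1 - genFun) * h + (PowerSeries.X : PowerSeries ℤ) * mk_one_subst_mul

/-- Dividing `A = X + A ^ 2` by `X` gives `B = 1 + X * B ^ 2`, the Catalan convolution recurrence.
-/
theorem coeff_genFun_eq_catalan (n : ℕ) : PowerSeries.coeff (n + 1) genFun = catalan n := by
  induction n using Nat.strong_induction_on with
  | _ n ih =>
    obtain ⟨B, hB⟩ := PowerSeries.X_dvd_iff.2 constantCoeff_genFun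
    have hcoeff : ∀ m, PowerSeries.coeff m B = PowerSeries.coeff (m + 1) genFun := by
      intro m
      rw [hB, PowerSeries.coeff_succ_X_mul]
    have hBeq : B = 1 + PowerSeries.X * B ^ 2 := by
      apply mul_left_cancel₀ (PowerSeries.X_ne_zero (R := ℤ))
      have := genFun_eq
      rw [hB] at this
      linear_combination this
    rw [← hcoeff]
    rcases n with _ | n
    · rw [hBeq]
      simp
    · rw [hBeq, map_add, PowerSeries.coeff_succ_X_mul, pow_two, PowerSeries.coeff_mul, catalan_succ',
        PowerSeries.coeff_one, if_neg (Nat.succ_ne_zero n), zero_add]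
      push_cast
      refine Finset.sum_congr rfl fun p hp => ?_
      have := Finset.HasAntidiagonal.mem_antidiagonal.1 hp
      rw [hcoeff, hcoeff, ih p.1 (by omega), ih p.2 (by omega)]

/-- With `S = 1 / (1 - A)`, the degree series without its root factor is `D = A * S ^ 2`. Since `A =
X * S` and `S = 1 + A + A ^ 2 * S`, it follows that `A = X * (1 + A + X * D)`; compare coefficients
at `n + 2`. -/
theorem sum_rootDegree_eq_sub (n : ℕ) :
    ∑ t : {t : OrderedTree // t.size = n + 1}, (t.1.rootDegree : ℤ) =
      PowerSeries.coeff (n + 2) genFun - PowerSeries.coeff (n + 1) genFun := by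
  set S : PowerSeries ℤ := (PowerSeries.mk (1 : ℕ → ℤ)).subst genFun with hS
  set D : PowerSeries ℤ := (PowerSeries.X *
    PowerSeries.derivative ℤ (PowerSeries.mk (1 : ℕ → ℤ))).subst genFun with hD
  have h1 : ∑ t : {t : OrderedTree // t.size = n + 1}, (t.1.rootDegree : ℤ) =
      PowerSeries.coeff n D := by
    rw [sum_rootDegree_eq (fun j => (j : ℤ)) n, coeff_subst_eq_sum_range constantCoeff_genFun]
    refine Finset.sum_congr rfl fun j _ => ?_
    rcases j with _ | j
    · simp
    · rw [PowerSeries.coeff_succ_X_mul, PowerSeries.coeff_derivative]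
      simp
  have h2 : D * (1 - genFun) = genFun * S := by
    have h3 : (PowerSeries.X * PowerSeries.derivative ℤ (PowerSeries.mk (1 : ℕ → ℤ))) *
        (1 - PowerSeries.X) = PowerSeries.X * PowerSeries.mk (1 : ℕ → ℤ) := by
      have h := congrArg (PowerSeries.derivative ℤ) (PowerSeries.mk_one_mul_one_sub_eq_one ℤ)
      simp only [Derivation.leibniz, map_sub, Derivation.map_one_eq_zero,
        PowerSeries.derivative_X, smul_eq_mul] at h
      linear_combination (PowerSeries.X : PowerSeries ℤ) * h
    have h := congrArg (PowerSeries.substAlgHom hasSubst_genFun) h3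
    rw [map_mul, map_mul _ PowerSeries.X (PowerSeries.mk 1), map_sub, map_one,
      PowerSeries.substAlgHom_X, PowerSeries.coe_substAlgHom] at h
    exact h
  have hS1 : S * (1 - genFun) = 1 := mk_one_subst_mul
  have hA : genFun = PowerSeries.X * S := genFun_eq_subst
  have h4 : genFun = PowerSeries.X * (1 + genFun + PowerSeries.X * D) := by
    have h5 : D = genFun * S ^ 2 := by linear_combination S * h2 - D * hS1
    rw [h5]
    linear_combination (1 + PowerSeries.X * genFun * S) * hA +
      PowerSeries.X * (1 + genFun) * hS1
  rw [h1]
  have h6 := congrArg (PowerSeries.coeff (n + 2)) h4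
  rw [PowerSeries.coeff_succ_X_mul, map_add, map_add, PowerSeries.coeff_succ_X_mul,
    PowerSeries.coeff_one, if_neg (Nat.succ_ne_zero n)] at h6
  rw [h6]
  ring

theorem avgRootDegree_eq (n : ℕ) :
    avgRootDegree (n + 1) = catalan (n + 1) / catalan n - 1 := by
  have h1 : (Fintype.card {t : OrderedTree // t.size = n + 1} : ℝ) = catalan n := by
    have := coeff_genFun_eq_catalan n
    rw [genFun, PowerSeries.coeff_mk] at this
    exact_mod_cast this
  have h2 := sum_rootDegree_eq_sub n
  rw [coeff_genFun_eq_catalan, coeff_genFun_eq_catalan] at h2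
  have h3 : (∑ t : {t : OrderedTree // t.size = n + 1}, (t.1.rootDegree : ℝ)) =
      catalan (n + 1) - catalan n := by exact_mod_cast h2
  have hc : (catalan n : ℝ) ≠ 0 := by
    have h := succ_mul_catalan_eq_centralBinom n
    have h' := Nat.centralBinom_pos n
    rw [← h] at h'
    exact_mod_cast (Nat.pos_of_mul_pos_left h').ne'
  rw [avgRootDegree, h1, h3, sub_div, div_self hc]

/-- The central binomial recurrence gives the ratio `2 (2 n + 1) / (n + 2)`. -/
theorem catalan_succ_div (n : ℕ) :
    (catalan (n + 1) : ℝ) / catalan n = 4 - 6 / (n + 2) := by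
  have h1 : (n + 1 : ℝ) * catalan n = n.centralBinom := by
    exact_mod_cast succ_mul_catalan_eq_centralBinom n
  have h2 : (n + 1 + 1 : ℝ) * catalan (n + 1) = (n + 1).centralBinom := by
    exact_mod_cast succ_mul_catalan_eq_centralBinom (n + 1)
  have h3 : (n + 1 : ℝ) * (n + 1).centralBinom = 2 * (2 * n + 1) * n.centralBinom := by
    exact_mod_cast Nat.succ_mul_centralBinom_succ n
  have h4 : (0 : ℝ) < n.centralBinom := by exact_mod_cast Nat.centralBinom_pos n
  have h5 : (n + 1 : ℝ) ≠ 0 := by positivity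
  have hc : (catalan n : ℝ) ≠ 0 := fun h => by
    rw [h, mul_zero] at h1
    exact h4.ne h1
  have h6 : (n + 2 : ℝ) ≠ 0 := by positivity
  rw [div_eq_iff hc]
  field_simp
  apply mul_left_cancel₀ h5
  linear_combination (n + 1 : ℝ) * h2 + h3 - 2 * (2 * n + 1) * h1

theorem tendsto_avgRootDegree : Filter.Tendsto avgRootDegree Filter.atTop (nhds 3) := by
  rw [← Filter.tendsto_add_atTop_iff_nat 1]
  have h : Filter.Tendsto (fun n : ℕ => (3 : ℝ) - 6 / (n + 2)) Filter.atTop (nhds 3) := by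
    have := (Filter.tendsto_atTop_add_const_right Filter.atTop (2 : ℝ)
      tendsto_natCast_atTop_atTop).const_div_atTop (6 : ℝ) |>.const_sub 3
    simpa using this
  refine h.congr fun n => ?_
  rw [avgRootDegree_eq, catalan_succ_div]
  ring

end OrderedTree

theorem mainTheorem5 :
    -- F = z + z w A / (1 - w A) ^ 2, with the denominator cleared
    (∀ w A : PowerSeries (Polynomial ℤ), w = PowerSeries.C Polynomial.X →
      A = PowerSeries.map Polynomial.C DistTree.genFun →
      DistTree.rootGenFun * (1 - w * A) ^ 2 =
        PowerSeries.X * (1 - w * A) ^ 2 + PowerSeries.X * (w * A)) ∧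
    -- the derivative with respect to w at w = 1 is z A (A + 1) / (1 - A) ^ 3
    DistTree.rootGenFunDeriv * (1 - DistTree.genFun) ^ 3 =
      PowerSeries.X * DistTree.genFun * (DistTree.genFun + 1) ∧
    (∀ n : ℕ, DistTree.avgRootDegree n =
      ((PowerSeries.coeff n DistTree.rootGenFunDeriv : ℤ) : ℝ) /
        ((PowerSeries.coeff n DistTree.genFun : ℤ) : ℝ)) ∧
    (∃ τ ρ c : ℝ, 0 < τ ∧ τ < 1 ∧ -1 + 3 * τ - τ ^ 2 + τ ^ 3 = 0 ∧
      ρ = τ / (1 + τ / (1 - τ) ^ 2) ∧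
      c = ρ * (1 + 4 * τ + τ ^ 2) / (1 - τ) ^ 4 ∧
      2.960894939 < c ∧ c < 2.960894940 ∧
      Filter.Tendsto DistTree.avgRootDegree Filter.atTop (nhds c)) ∧
    Filter.Tendsto OrderedTree.avgRootDegree Filter.atTop (nhds 3) := by
  obtain ⟨τ, hτ, h1, h2⟩ := DistTree.exists_isCritical
  obtain ⟨hlow, hup⟩ := DistTree.avgRootDegree_limit_bounds h1 h2
  exact ⟨DistTree.rootGenFun_mul, DistTree.rootGenFunDeriv_mul, DistTree.avgRootDegree_eq,
    ⟨τ, _, _, hτ.1, hτ.2.1, hτ.2.2, rfl, rfl, hlow, hup, DistTree.tendsto_avgRootDegree hτ⟩,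
    OrderedTree.tendsto_avgRootDegree⟩
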